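/- Consider the infinite qubit chain with sites $\mathbb Z$. For $\xi=(\xi_X,\xi_Z):\mathbb Z\to\mathbb Z_2^2$ of finite support let $\mathbf w(\xi)=\bigotimes_{x}X^{\xi_X(x)}Z^{\xi_Z(x)}$ be the corresponding Pauli product, and for $R\subseteq\mathbb Z$ let $\mathfrak A_R$ be the $C^*$-algebra generated by the $\mathbf w(\xi)$ with support in $R$; write $\mathfrak A=\mathfrak A_{\mathbb Z}$. A state is a normalized positive linear functional on $\mathfrak A$. An operator $S\in\mathfrak A$ stabilizes a state $\omega$ if $\omega(Sa)=\omega(a)$ for all $a\in\mathfrak A$. A pure translation-invariant stabilizer state with generator $\xi$ is a pure state $\omega$ that is stabilized by all translates $S_x=\theta\,\mathbf w(\tau_x\xi)$, $x\in\mathbb Z$ (where $\theta$ is a fixed phase), and is the only state with this property. The generator length is the length of the smallest interval containing the support of $\xi$. For $k\in\mathbb Z$ cut the chain into $\mathscr A=\{x<k\}$ and $\mathscr B=\{x\ge k\}$. We say that $\mathscr A$ and $\mathscr B$ share $m$ maximally entangled (logical) qubit pairs in $\omega$ if there are self-adjoint $\bar X^{A}_i,\bar Z^{A}_i\in\mathfrak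 A_{\mathscr A}$ and $\bar X^{B}_i,\bar Z^{B}_i\in\mathfrak A_{\mathscr B}$, $1\le i\le m$, such that on each side the operators square to $1$, $\bar X_i$ anticommutes with $\bar Z_i$, and all other pairs of these operators commute, and such that all $\bar X^A_i\bar X^B_i$ and $\bar Z^A_i\bar Z^B_i$ stabilize $\omega$ (so that each logical pair is in a Bell state). **Theorem.** Let $\omega$ be a pure translation-invariant stabilizer state with generator $\xi$. Then the generator length is odd, say $2n+1$ with $n\ge 0$, and for every cut $k\in\mathbb Z$ the two half-chains share exactly $n$ maximally entangled logical qubit pairs: they share $n$ such pairs, and $n$ is the largest $m$ for which they share $m$ pairs. Moreover the operators $\bar X^A_i,\bar Z^A_i,\bar X^B_i,\bar Z^B_i$ of $n$ such pairs can be chosen to be products of Pauli matrices on finitely many sites, up to phases. -/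

import Mathlib

open scoped ComplexOrder

noncomputable section

namespace QubitChain

/-- Classical configurations of the chain (computational basis labels), equal to `0` at all but
finitely many sites. -/
abbrev Config : Type := ℤ →₀ ZMod 2

/-- The Hilbert space with orthonormal basis `|c⟩`, `c` a configuration. The observables of the
infinite qubit chain act faithfully on it; states of the chain are functionals on the observable
algebra below, not vectors of this space. -/
abbrev ChainSpace : Type := lp (fun _ : Config => ℂ) 2

/-- Phase space: `ξ x = (ξ_X x, ξ_Z x)`, with finitely many nonzero entries. -/
abbrev Phase : Type := ℤ →₀ ZMod 2 × ZMod 2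

/-- The string `ξ_X`. -/
def xPart (ξ : Phase) : Config := ξ.mapRange Prod.fst rfl

/-- The string `ξ_Z`. -/
def zPart (ξ : Phase) : Config := ξ.mapRange Prod.snd rfl

/-- The scalar product modulo `2` of two strings. -/
def dot (b c : Config) : ZMod 2 := b.sum fun x t => t * c x

/-- The sign `(-1) ^ (b · c)`. -/
def signChar (b c : Config) : ℂ := (-1) ^ (dot b c).val

theorem norm_signChar (b c : Config) : ‖signChar b c‖ = 1 := by
  simp [signChar]

theorem memℓp_flip_sign (a b : Config) (f : ChainSpace) :
    Memℓp (fun c : Config => signChar b (c + a) * f (c + a)) 2 := by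
  have hf := (memℓp_gen_iff (p := 2) (by norm_num)).1 (lp.memℓp f)
  refine (memℓp_gen_iff (p := 2) (by norm_num)).2 ?_
  have := hf.comp_injective (add_left_injective a)
  simpa [norm_signChar, Function.comp_def] using this

theorem norm_flip_sign (a b : Config) (f : ChainSpace) :
    ‖(⟨fun c => signChar b (c + a) * f (c + a), memℓp_flip_sign a b f⟩ : ChainSpace)‖ = ‖f‖ := by
  rw [lp.norm_eq_tsum_rpow (by norm_num), lp.norm_eq_tsum_rpow (by norm_num)]
  congr 1
  have := (Equiv.addRight a).tsum_eq (fun c : Config => ‖f c‖ ^ (2 : ENNReal).toReal)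
  rw [← this]
  refine tsum_congr fun c => ?_
  simp [norm_signChar]

/-- The tensor product of Pauli matrices with label `ξ`, namely `w(ξ) = ⨂ₓ X ^ ξ_X(x) Z ^ ξ_Z(x)`,
so that `w(ξ)|c⟩ = (-1) ^ (ξ_Z · c) |c + ξ_X⟩`. At each site
`w(1,0) = X`, `w(0,1) = Z`, `w(0,0) = 1`, `i w(1,1) = Y`. -/
def weylOp (ξ : Phase) : ChainSpace →L[ℂ] ChainSpace :=
  LinearIsometry.toContinuousLinearMap
    { toFun := fun f =>
        ⟨fun c => signChar (zPart ξ) (c + xPart ξ) * f (c + xPart ξ),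
          memℓp_flip_sign (xPart ξ) (zPart ξ) f⟩
      map_add' := fun f g => by
        ext c
        exact mul_add _ _ _
      map_smul' := fun t f => by
        ext c
        simp [mul_left_comm]
      norm_map' := norm_flip_sign (xPart ξ) (zPart ξ) }

/-- The C⋆-algebra of (quasi-local) observables of the region `R`: the norm closed unital
⋆-algebra generated by the Pauli products supported in `R`. -/
def observables (R : Set ℤ) : StarSubalgebra ℂ (ChainSpace →L[ℂ] ChainSpace) :=
  (StarAlgebra.adjoin ℂ {T | ∃ ξ : Phase, (∀ x, ξ x ≠ 0 → x ∈ R) ∧ T = weylOp ξ}).topologicalClosure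

/-- The observable algebra of the whole chain. -/
abbrev Chain : Type := observables Set.univ

/-- The Pauli product `w(ξ)` as an observable of the chain. -/
def weyl (ξ : Phase) : Chain :=
  ⟨weylOp ξ, StarSubalgebra.le_topologicalClosure _
    (StarAlgebra.subset_adjoin ℂ _ ⟨ξ, fun _ _ => Set.mem_univ _, rfl⟩)⟩

/-- States: normalized positive linear functionals on the observable algebra. -/
def states : Set (Chain →ₗ[ℂ] ℂ) :=
  {ω | ω 1 = 1 ∧ ∀ a : Chain, 0 ≤ ω (star a * a)}

/-- Pure states: extreme points of the convex set of states. -/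
def pureStates : Set (Chain →ₗ[ℂ] ℂ) := Set.extremePoints ℝ states

/-- The operator `S` stabilizes `ω`: the condition `ω ∘ S = ω`. -/
def Stabilizes (S : Chain) (ω : Chain →ₗ[ℂ] ℂ) : Prop := ∀ a : Chain, ω (S * a) = ω a

/-- Lattice translation by `x` sites, `(τ_x ξ)(y) = ξ (y - x)`. -/
def translate (x : ℤ) (ξ : Phase) : Phase := ξ.equivMapDomain (Equiv.addRight x)

/-- `ω` is the pure translation-invariant stabilizer state defined by the translation-invariant set
of generators `S_x = θ w(τ_x ξ)`, `x ∈ ℤ`, where `θ` is a phase: `ω` is a pure state, it is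
stabilized by all `S_x`, and it is determined by this property. -/
structure IsPureStabilizerState (ω : Chain →ₗ[ℂ] ℂ) (θ : ℂ) (ξ : Phase) : Prop where
  phase : ‖θ‖ = 1
  pure : ω ∈ pureStates
  stabilized : ∀ x : ℤ, Stabilizes (θ • weyl (translate x ξ)) ω
  determined : ∀ φ ∈ states, (∀ x : ℤ, Stabilizes (θ • weyl (translate x ξ)) φ) → φ = ω

/-- The length of (the Pauli product with label) `ξ`: the number of sites of the smallest interval
that contains its support. -/
def length (ξ : Phase) : ℕ :=
  if h : ξ.support.Nonempty then (ξ.support.max' h - ξ.support.min' h + 1).toNat else 0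

/-- `X i`, `Z i` (`i < m`) are the Pauli operators of `m` distinct logical qubits. -/
structure LogicalPaulis {m : ℕ} (X Z : Fin m → Chain) : Prop where
  star_X : ∀ i, star (X i) = X i
  star_Z : ∀ i, star (Z i) = Z i
  X_sq : ∀ i, X i * X i = 1
  Z_sq : ∀ i, Z i * Z i = 1
  anticomm : ∀ i, X i * Z i = -(Z i * X i)
  comm_XX : ∀ i j, X i * X j = X j * X i
  comm_ZZ : ∀ i j, Z i * Z j = Z j * Z i
  comm_XZ : ∀ i j, i ≠ j → X i * Z j = Z j * X i

/-- For the cut of the chain into the half-chains `{x | x < k}` and `{x | k ≤ x}`: the logical qubits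
`(XA i, ZA i)` of the first half-chain and `(XB i, ZB i)` of the second form `m` maximally entangled
pairs in the state `ω`, that is, the `i`-th pair is in the Bell state stabilized by `X ⊗ X` and
`Z ⊗ Z`. -/
structure MaximallyEntangledPairs (ω : Chain →ₗ[ℂ] ℂ) (k : ℤ) {m : ℕ}
    (XA ZA XB ZB : Fin m → Chain) : Prop where
  XA_mem : ∀ i, (XA i : ChainSpace →L[ℂ] ChainSpace) ∈ observables (Set.Iio k)
  ZA_mem : ∀ i, (ZA i : ChainSpace →L[ℂ] ChainSpace) ∈ observables (Set.Iio k)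
  XB_mem : ∀ i, (XB i : ChainSpace →L[ℂ] ChainSpace) ∈ observables (Set.Ici k)
  ZB_mem : ∀ i, (ZB i : ChainSpace →L[ℂ] ChainSpace) ∈ observables (Set.Ici k)
  logicalA : LogicalPaulis XA ZA
  logicalB : LogicalPaulis XB ZB
  bell_X : ∀ i, Stabilizes (XA i * XB i) ω
  bell_Z : ∀ i, Stabilizes (ZA i * ZB i) ω

/-- The entanglement of `ω` with respect to the cut at `k`: the (largest) number of maximally
entangled logical qubit pairs shared by the two half-chains. -/
def entanglement (ω : Chain →ₗ[ℂ] ℂ) (k : ℤ) : ℕ∞ :=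
  ⨆ (m : ℕ) (_ : ∃ XA ZA XB ZB : Fin m → Chain, MaximallyEntangledPairs ω k XA ZA XB ZB), (m : ℕ∞)

/-- `a` is a product of Pauli matrices on finitely many sites, up to a phase. -/
def IsPauliProduct (a : Chain) : Prop := ∃ (c : ℂ) (η : Phase), ‖c‖ = 1 ∧ a = c • weyl η

end QubitChain

end

noncomputable section

namespace QubitChain

/-! Up to phases, Pauli products are vectors of a symplectic space over `ZMod 2`, and the stabilizer
group is the span G of the translates of ξ. G is isotropic, since anticommuting stabilizers cannot
share a state. It is also maximal (`mem_translateSpan_of_symp_eq_zero`): let η commute with G but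
lie outside it. Flipping signs by a functional that vanishes on G but not at η gives a state with
the same stabilizers, so uniqueness forces ω(w(η)) = 0. Conditioning on the value 1 of w(η) (with a
phase) then gives a second stabilized state, a contradiction.

Let the support of ξ span [a, b]. Exactly b - a translates cross a given cut. Their left halves
carry the commutation form `crossingForm`. If a combination of left halves commutes with all of
them, it commutes with every translate, so it lies in G by maximality, and comparing supports shows
that it is trivial. The form is thus alternating and nondegenerate, and b - a = 2n. Whole
stabilizers commute, so right halves have the same commutation relations as left halves, and the
halves of a symplectic basis are n Bell pairs (`exists_pauli_pairs`).

For the upper bound, ω(xy) with x on the left and y on the right is a sum of 2^(b - a) products of a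
function of x and a function of y (`apply_mul_eq_sum`). The 4^m logical words of m Bell pairs have
the identity as correlation matrix, so 4^m ≤ 2^(b - a) by rank
(`MaximallyEntangledPairs.two_mul_le`). -/

/-! ### Weyl relations and the symplectic form -/

/-- The character `t ↦ (-1) ^ t` of `ZMod 2`. -/
def sgn (t : ZMod 2) : ℂ := (-1) ^ t.val

@[simp] theorem sgn_zero : sgn 0 = 1 := by simp [sgn]

@[simp] theorem sgn_one : sgn 1 = -1 := by simp [sgn, ZMod.val_one]

theorem zmod_two_cases (t : ZMod 2) : t = 0 ∨ t = 1 := by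
  revert t
  decide

theorem sgn_add (s t : ZMod 2) : sgn (s + t) = sgn s * sgn t := by
  rcases zmod_two_cases s with rfl | rfl <;> rcases zmod_two_cases t with rfl | rfl <;>
    simp [show (1 + 1 : ZMod 2) = 0 from rfl]

@[simp] theorem sgn_mul_self (s : ZMod 2) : sgn s * sgn s = 1 := by
  rcases zmod_two_cases s with rfl | rfl <;> simp

@[simp] theorem norm_sgn (s : ZMod 2) : ‖sgn s‖ = 1 := by simp [sgn]

theorem dot_add_left (b b' c : Config) : dot (b + b') c = dot b c + dot b' c := by
  unfold dot
  exact Finsupp.sum_add_index' (by simp) (by intros; ring)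

theorem dot_add_right (b c c' : Config) : dot b (c + c') = dot b c + dot b c' := by
  simp [dot, Finsupp.sum, mul_add, Finset.sum_add_distrib]

theorem dot_smul_left (t : ZMod 2) (b c : Config) : dot (t • b) c = t * dot b c := by
  unfold dot
  rw [Finsupp.sum_smul_index (by simp), Finsupp.mul_sum]
  exact Finsupp.sum_congr fun x _ => by simp [mul_assoc]

theorem dot_smul_right (t : ZMod 2) (b c : Config) : dot b (t • c) = t * dot b c := by
  unfold dot
  rw [Finsupp.mul_sum]
  exact Finsupp.sum_congr fun x _ => by simp [mul_left_comm]

theorem xPart_add (ξ η : Phase) : xPart (ξ + η) = xPart ξ + xPart η := by ext; simp [xPart]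

theorem zPart_add (ξ η : Phase) : zPart (ξ + η) = zPart ξ + zPart η := by ext; simp [zPart]

theorem xPart_smul (t : ZMod 2) (ξ : Phase) : xPart (t • ξ) = t • xPart ξ := by ext; simp [xPart]

theorem zPart_smul (t : ZMod 2) (ξ : Phase) : zPart (t • ξ) = t • zPart ξ := by ext; simp [zPart]

/-- The cocycle `ξ_Z · η_X` of the Weyl multiplication. -/
def cocycle : Phase →ₗ[ZMod 2] Phase →ₗ[ZMod 2] ZMod 2 :=
  LinearMap.mk₂ (ZMod 2) (fun ξ η => dot (zPart ξ) (xPart η))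
    (fun _ _ _ => by rw [zPart_add, dot_add_left])
    (fun _ _ _ => by rw [zPart_smul, dot_smul_left, smul_eq_mul])
    (fun _ _ _ => by rw [xPart_add, dot_add_right])
    (fun _ _ _ => by rw [xPart_smul, dot_smul_right, smul_eq_mul])

/-- The symplectic form on phase space, which tells whether two Pauli products commute. -/
def symp : Phase →ₗ[ZMod 2] Phase →ₗ[ZMod 2] ZMod 2 := cocycle + cocycle.flip

theorem cocycle_apply (ξ η : Phase) : cocycle ξ η = ∑ x ∈ ξ.support, (ξ x).2 * (η x).1 := by
  change dot (zPart ξ) (xPart η) = _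
  unfold dot zPart xPart
  rw [Finsupp.sum_mapRange_index (by simp)]
  simp [Finsupp.sum]

theorem symp_apply (ξ η : Phase) : symp ξ η = cocycle ξ η + cocycle η ξ := rfl

theorem symp_comm (ξ η : Phase) : symp ξ η = symp η ξ := by
  rw [symp_apply, symp_apply, add_comm]

theorem symp_self (ξ : Phase) : symp ξ ξ = 0 := by
  rw [symp_apply]
  exact CharTwo.add_self_eq_zero _

theorem cocycle_eq_zero_of_disjoint {ξ η : Phase} (h : ∀ x, ξ x = 0 ∨ η x = 0) :
    cocycle ξ η = 0 := by
  rw [cocycle_apply]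
  refine Finset.sum_eq_zero fun x _ => ?_
  rcases h x with h | h <;> simp [h]

theorem symp_eq_zero_of_disjoint {ξ η : Phase} (h : ∀ x, ξ x = 0 ∨ η x = 0) :
    symp ξ η = 0 := by
  rw [symp_apply, cocycle_eq_zero_of_disjoint h,
    cocycle_eq_zero_of_disjoint fun x => (h x).symm, add_zero]

theorem symp_single_left (x : ℤ) (a : ZMod 2 × ZMod 2) (η : Phase) :
    symp (Finsupp.single x a) η = a.2 * (η x).1 + a.1 * (η x).2 := by
  have h1 : cocycle (Finsupp.single x a) η = a.2 * (η x).1 := by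
    rw [cocycle_apply]
    rw [Finset.sum_subset Finsupp.support_single_subset]
    · simp
    · intro y hy h
      rw [Finsupp.notMem_support_iff] at h
      simp [h]
  have h2 : cocycle η (Finsupp.single x a) = a.1 * (η x).2 := by
    rw [cocycle_apply, Finset.sum_eq_single x]
    · simp [mul_comm]
    · intro y _ hy
      simp [Finsupp.single_eq_of_ne hy]
    · intro h
      rw [Finsupp.notMem_support_iff] at h
      simp [h]
  rw [symp_apply, h1, h2]

theorem weylOp_apply (ξ : Phase) (f : ChainSpace) (c : Config) :
    weylOp ξ f c = sgn (dot (zPart ξ) (c + xPart ξ)) * f (c + xPart ξ) := rfl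

theorem weylOp_mul (ξ η : Phase) : weylOp ξ * weylOp η = sgn (cocycle ξ η) • weylOp (ξ + η) := by
  ext f c
  change weylOp ξ (weylOp η f) c = sgn (dot (zPart ξ) (xPart η)) * weylOp (ξ + η) f c
  rw [weylOp_apply, weylOp_apply, weylOp_apply, xPart_add, zPart_add, dot_add_left, add_assoc,
    dot_add_right (zPart ξ) c (xPart ξ + _), dot_add_right (zPart ξ) c (xPart ξ),
    dot_add_right (zPart ξ) (xPart ξ) (xPart η)]
  simp only [sgn_add]
  have := sgn_mul_self (dot (zPart ξ) (xPart η))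
  -- The two sides differ by the square of the cocycle sign.
  linear_combination (-(sgn (dot (zPart ξ) c) * sgn (dot (zPart ξ) (xPart ξ)) *
    sgn (dot (zPart η) (c + (xPart ξ + xPart η))) * f (c + (xPart ξ + xPart η)))) * this

theorem weylOp_zero : weylOp 0 = 1 := by
  ext f c
  rw [weylOp_apply]
  simp [xPart, zPart, dot]

theorem add_self_phase (ξ : Phase) : ξ + ξ = 0 := by
  ext x <;> simp [CharTwo.add_self_eq_zero]

/-- An isometry has its adjoint as left inverse, while w(ξ)² = ±1 provides an explicit right
inverse; the two agree. -/
theorem star_weylOp (ξ : Phase) : star (weylOp ξ) = sgn (cocycle ξ ξ) • weylOp ξ := by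
  have h1 : star (weylOp ξ) * weylOp ξ = 1 := by
    rw [ContinuousLinearMap.star_eq_adjoint]
    exact (ContinuousLinearMap.norm_map_iff_adjoint_comp_self _).1
      (norm_flip_sign (xPart ξ) (zPart ξ))
  have h2 : weylOp ξ * (sgn (cocycle ξ ξ) • weylOp ξ) = 1 := by
    rw [mul_smul_comm, weylOp_mul, add_self_phase, weylOp_zero, smul_smul, sgn_mul_self, one_smul]
  exact left_inv_eq_right_inv h1 h2

theorem weyl_mul (ξ η : Phase) : weyl ξ * weyl η = sgn (cocycle ξ η) • weyl (ξ + η) :=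
  Subtype.ext (weylOp_mul ξ η)

@[simp] theorem weyl_zero : weyl 0 = 1 := Subtype.ext weylOp_zero

theorem star_weyl (ξ : Phase) : star (weyl ξ) = sgn (cocycle ξ ξ) • weyl ξ :=
  Subtype.ext (star_weylOp ξ)

theorem weyl_mul_self (ξ : Phase) : weyl ξ * weyl ξ = sgn (cocycle ξ ξ) • (1 : Chain) := by
  rw [weyl_mul, add_self_phase, weyl_zero]

theorem weyl_mul_comm (ξ η : Phase) : weyl ξ * weyl η = sgn (symp ξ η) • (weyl η * weyl ξ) := by
  rw [weyl_mul, weyl_mul, add_comm η, smul_smul, symp_apply, sgn_add, mul_assoc, sgn_mul_self,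
    mul_one]

/-! ### Local observables and reduction to Pauli products -/

/-- The label `ξ` is supported in the region `R`. -/
def SupportedIn (R : Set ℤ) (ξ : Phase) : Prop := ∀ x, ξ x ≠ 0 → x ∈ R

theorem SupportedIn.add {R : Set ℤ} {ξ η : Phase} (hξ : SupportedIn R ξ) (hη : SupportedIn R η) :
    SupportedIn R (ξ + η) := fun x hx => by
  by_contra h
  have h1 : ξ x = 0 := not_not.1 fun h' => h (hξ x h')
  have h2 : η x = 0 := not_not.1 fun h' => h (hη x h')
  exact hx (by simp [h1, h2])

theorem weylOp_mem_observables {R : Set ℤ} {ξ : Phase} (hξ : SupportedIn R ξ) :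
    weylOp ξ ∈ observables R :=
  StarSubalgebra.le_topologicalClosure _ (StarAlgebra.subset_adjoin ℂ _ ⟨ξ, hξ, rfl⟩)

/-- Products and adjoints of Pauli products are Pauli products up to sign, so their linear span is
already a star algebra. -/
theorem adjoin_weylOp_subset_span (R : Set ℤ) {T : ChainSpace →L[ℂ] ChainSpace}
    (hT : T ∈ StarAlgebra.adjoin ℂ {T | ∃ ξ : Phase, (∀ x, ξ x ≠ 0 → x ∈ R) ∧ T = weylOp ξ}) :
    T ∈ Submodule.span ℂ {T | ∃ ξ : Phase, SupportedIn R ξ ∧ T = weylOp ξ} := by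
  induction hT using StarAlgebra.adjoin_induction with
  | mem x hx => exact Submodule.subset_span hx
  | algebraMap r =>
    rw [Algebra.algebraMap_eq_smul_one]
    exact Submodule.smul_mem _ _ (Submodule.subset_span ⟨0, by simp [SupportedIn], weylOp_zero.symm⟩)
  | add x y _ _ hx hy => exact Submodule.add_mem _ hx hy
  | mul x y hx' hy' hx hy =>
    clear hx' hy'
    induction hx using Submodule.span_induction with
    | zero => simp
    | add a b _ _ ha hb => rw [add_mul]; exact Submodule.add_mem _ ha hb
    | smul t a _ ha => rw [smul_mul_assoc]; exact Submodule.smul_mem _ _ ha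
    | mem a ha =>
      obtain ⟨ξ, hξ, rfl⟩ := ha
      induction hy using Submodule.span_induction with
      | zero => simp
      | add a b _ _ ha hb => rw [mul_add]; exact Submodule.add_mem _ ha hb
      | smul t a _ ha => rw [mul_smul_comm]; exact Submodule.smul_mem _ _ ha
      | mem b hb =>
        obtain ⟨η, hη, rfl⟩ := hb
        rw [weylOp_mul]
        exact Submodule.smul_mem _ _ (Submodule.subset_span ⟨_, hξ.add hη, rfl⟩)
  | star x hx' hx =>
    clear hx'
    induction hx using Submodule.span_induction with
    | zero => simp
    | add a b _ _ ha hb => rw [star_add]; exact Submodule.add_mem _ ha hb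
    | smul t a _ ha => rw [star_smul]; exact Submodule.smul_mem _ _ ha
    | mem a ha =>
      obtain ⟨ξ, hξ, rfl⟩ := ha
      rw [star_weylOp]
      exact Submodule.smul_mem _ _ (Submodule.subset_span ⟨_, hξ, rfl⟩)

/-- A closed linear condition that holds for the Pauli products supported in `R` holds for all
observables of `R`. -/
theorem observables_induction {R : Set ℤ} {p : Chain → Prop} (hclosed : IsClosed {a | p a})
    (hzero : p 0) (hadd : ∀ a b, p a → p b → p (a + b)) (hsmul : ∀ (t : ℂ) a, p a → p (t • a))
    (hweyl : ∀ ξ, SupportedIn R ξ → p (weyl ξ)) (a : Chain)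
    (ha : (a : ChainSpace →L[ℂ] ChainSpace) ∈ observables R) : p a := by
  let S : Submodule ℂ (ChainSpace →L[ℂ] ChainSpace) :=
    Submodule.map (Subalgebra.toSubmodule (observables Set.univ).toSubalgebra).subtype
      { carrier := {a | p a}
        zero_mem' := hzero
        add_mem' := fun {a b} => hadd a b
        smul_mem' := fun t a => hsmul t a }
  have hS : IsClosed (S : Set (ChainSpace →L[ℂ] ChainSpace)) := by
    have h : IsClosed ((observables Set.univ : StarSubalgebra ℂ _) :
        Set (ChainSpace →L[ℂ] ChainSpace)) := StarSubalgebra.isClosed_topologicalClosure _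
    exact h.isClosedEmbedding_subtypeVal.isClosedMap _ hclosed
  have hle : closure ((StarAlgebra.adjoin ℂ
      {T | ∃ ξ : Phase, (∀ x, ξ x ≠ 0 → x ∈ R) ∧ T = weylOp ξ} :
        StarSubalgebra ℂ (ChainSpace →L[ℂ] ChainSpace)) : Set _) ⊆
        (S : Set (ChainSpace →L[ℂ] ChainSpace)) := by
    refine closure_minimal (fun T hT => ?_) hS
    refine Submodule.span_le.2 ?_ (adjoin_weylOp_subset_span R hT)
    rintro _ ⟨ξ, hξ, rfl⟩
    exact ⟨weyl ξ, hweyl ξ hξ, rfl⟩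
  obtain ⟨b, hb, hba⟩ := hle ha
  rwa [← Subtype.ext hba]

theorem weyl_commute_of_disjoint {ξ η : Phase} (h : ∀ x, ξ x = 0 ∨ η x = 0) :
    weyl ξ * weyl η = weyl η * weyl ξ := by
  rw [weyl_mul_comm, symp_eq_zero_of_disjoint h, sgn_zero, one_smul]

theorem SupportedIn.disjoint {R R' : Set ℤ} (hR : Disjoint R R') {ξ η : Phase}
    (hξ : SupportedIn R ξ) (hη : SupportedIn R' η) (x : ℤ) : ξ x = 0 ∨ η x = 0 := by
  by_contra! h
  exact Set.disjoint_left.1 hR (hξ x h.1) (hη x h.2)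

/-- Observables of disjoint regions commute. -/
theorem observables_commute {R R' : Set ℤ} (hR : Disjoint R R') (a b : Chain)
    (ha : (a : ChainSpace →L[ℂ] ChainSpace) ∈ observables R)
    (hb : (b : ChainSpace →L[ℂ] ChainSpace) ∈ observables R') : a * b = b * a := by
  refine observables_induction (p := fun a => a * b = b * a) ?_ (by simp)
    (fun a a' h h' => by simp only [add_mul, mul_add, h, h'])
    (fun t a h => by simp only [smul_mul_assoc, mul_smul_comm, h]) (fun ξ hξ => ?_) a ha
  · exact isClosed_eq (by fun_prop) (by fun_prop)
  refine observables_induction (p := fun b => weyl ξ * b = b * weyl ξ) ?_ (by simp)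
    (fun a a' h h' => by simp only [add_mul, mul_add, h, h'])
    (fun t a h => by simp only [smul_mul_assoc, mul_smul_comm, h]) (fun η hη => ?_) b hb
  · exact isClosed_eq (by fun_prop) (by fun_prop)
  exact weyl_commute_of_disjoint (hξ.disjoint hR hη)


/-! ### States and their stabilizers -/

/-- In the spectral order the positive elements are those of the form b*b, and positive functionals
on a C⋆-algebra are bounded. -/
theorem continuous_of_nonneg_star_mul_self {A : Type*} [CStarAlgebra A] (f : A →ₗ[ℂ] ℂ)
    (hf : ∀ a, 0 ≤ f (star a * a)) : Continuous f := by
  let _ : PartialOrder A := CStarAlgebra.spectralOrder A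
  have _ : StarOrderedRing A := CStarAlgebra.spectralOrderedRing A
  obtain ⟨C, hC⟩ := PositiveLinearMap.exists_norm_apply_le (PositiveLinearMap.mk₀ f fun a ha => by
    obtain ⟨b, rfl⟩ := CStarAlgebra.nonneg_iff_eq_star_mul_self.1 ha
    exact hf b)
  exact AddMonoidHomClass.continuous_of_bound f C hC

theorem isClosed_observables_univ :
    IsClosed ((observables Set.univ : StarSubalgebra ℂ (ChainSpace →L[ℂ] ChainSpace)) :
      Set (ChainSpace →L[ℂ] ChainSpace)) :=
  StarSubalgebra.isClosed_topologicalClosure _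

theorem continuous_of_mem_states {ω : Chain →ₗ[ℂ] ℂ} (hω : ω ∈ states) : Continuous ω :=
  have := isClosed_observables_univ
  continuous_of_nonneg_star_mul_self (A := Chain) ω hω.2

/-- Polarization: positivity at 1 + a and at 1 + ia makes the imaginary parts of the cross terms
vanish. -/
theorem map_star_of_mem_states {ω : Chain →ₗ[ℂ] ℂ} (hω : ω ∈ states) (a : Chain) :
    ω (star a) = star (ω a) := by
  have h0 := (Complex.nonneg_iff.1 (hω.2 a)).2
  have h1 := (Complex.nonneg_iff.1 (hω.2 (1 + a))).2
  have h2 := (Complex.nonneg_iff.1 (hω.2 (1 + Complex.I • a))).2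
  simp only [star_add, star_one, add_mul, mul_add, one_mul, mul_one, map_add, hω.1, star_smul,
    smul_mul_assoc, mul_smul_comm, map_smul] at h1 h2
  simp [← h0] at h1 h2
  apply Complex.ext
  · simp; linarith
  · simp; linarith

theorem Stabilizes.mul {S T : Chain} {ω : Chain →ₗ[ℂ] ℂ} (hS : Stabilizes S ω)
    (hT : Stabilizes T ω) : Stabilizes (S * T) ω := fun a => by
  rw [mul_assoc, hS, hT]

theorem stabilizes_one (ω : Chain →ₗ[ℂ] ℂ) : Stabilizes 1 ω := fun a => by rw [one_mul]

theorem Stabilizes.of_left_inv {S T : Chain} {ω : Chain →ₗ[ℂ] ℂ} (hS : Stabilizes S ω)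
    (h : S * T = 1) : Stabilizes T ω := fun a => by
  rw [← hS, ← mul_assoc, h, one_mul]

/-- A unitary that stabilizes a state also satisfies `ω (a * S) = ω a`. -/
theorem Stabilizes.right {S : Chain} {ω : Chain →ₗ[ℂ] ℂ} (hω : ω ∈ states) (hS : Stabilizes S ω)
    (h : S * star S = 1) (a : Chain) : ω (a * S) = ω a := by
  have h1 : ω (star S * star a) = ω (star a) := hS.of_left_inv h _
  rw [← star_mul, map_star_of_mem_states hω, map_star_of_mem_states hω] at h1
  exact star_injective h1

/-- An observable that anticommutes with a unitary stabilizer has expectation `0`. -/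
theorem Stabilizes.apply_eq_zero_of_anticommute {S : Chain} {ω : Chain →ₗ[ℂ] ℂ} (hω : ω ∈ states)
    (hS : Stabilizes S ω) (h : S * star S = 1) {a : Chain} (ha : S * a = -(a * S)) : ω a = 0 := by
  have h1 : ω a = -ω a := by
    conv_lhs => rw [← hS, ha, map_neg, hS.right hω h]
  exact self_eq_neg.1 h1

theorem weyl_mul_star_self (ξ : Phase) : weyl ξ * star (weyl ξ) = 1 := by
  rw [star_weyl, mul_smul_comm, weyl_mul_self, smul_smul, sgn_mul_self, one_smul]

theorem star_mul_weyl_self (ξ : Phase) : star (weyl ξ) * weyl ξ = 1 := by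
  rw [star_weyl, smul_mul_assoc, weyl_mul_self, smul_smul, sgn_mul_self, one_smul]

theorem mul_star_self_of_norm_eq_one {μ : ℂ} (h : ‖μ‖ = 1) : μ * star μ = 1 := by
  rw [RCLike.star_def, Complex.mul_conj, Complex.normSq_eq_norm_sq, h]
  simp

theorem smul_weyl_mul_star_self {μ : ℂ} (h : ‖μ‖ = 1) (ξ : Phase) :
    (μ • weyl ξ) * star (μ • weyl ξ) = 1 := by
  rw [star_smul, smul_mul_assoc, mul_smul_comm, weyl_mul_star_self, smul_smul,
    mul_star_self_of_norm_eq_one h, one_smul]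

theorem norm_weyl_le (ξ : Phase) : ‖weyl ξ‖ ≤ 1 :=
  LinearIsometry.norm_toContinuousLinearMap_le _


/-! ### The stabilizer group and its maximality -/

open Filter Topology

/-- The subspace of phase space spanned by the translates of `ξ`. -/
def translateSpan (ξ : Phase) : Submodule (ZMod 2) Phase :=
  Submodule.span (ZMod 2) (Set.range fun x => translate x ξ)

/-- Here w(η)² = ±1, and a factor i repairs the negative sign. -/
theorem exists_phase_isSelfAdjoint (η : Phase) :
    ∃ c : ℂ, ‖c‖ = 1 ∧ star (c • weyl η) = c • weyl η ∧ (c • weyl η) * (c • weyl η) = 1 := by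
  simp only [star_smul, star_weyl, smul_mul_assoc, mul_smul_comm, weyl_mul_self, smul_smul]
  rcases zmod_two_cases (cocycle η η) with h | h
  · exact ⟨1, by simp, by simp [h], by simp [h]⟩
  · exact ⟨Complex.I, by simp, by simp [h], by simp [h]⟩

/-- A stabilizer has expectation 1, but anticommuting with another unitary stabilizer would make it
0. -/
theorem symp_eq_zero_of_stabilizes {ω : Chain →ₗ[ℂ] ℂ} (hω : ω ∈ states) {μ ν : ℂ} (hμ : ‖μ‖ = 1)
    {g h : Phase} (hg : Stabilizes (μ • weyl g) ω)
    (hh : Stabilizes (ν • weyl h) ω) : symp g h = 0 := by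
  by_contra hne
  have h1 : symp g h = 1 := (zmod_two_cases _).resolve_left hne
  have h2 : ω (ν • weyl h) = 0 := by
    refine hg.apply_eq_zero_of_anticommute hω (smul_weyl_mul_star_self hμ g) ?_
    rw [smul_mul_smul_comm, smul_mul_smul_comm, weyl_mul_comm, h1, sgn_one, neg_one_smul, smul_neg,
      mul_comm]
  have h3 := hh 1
  rw [mul_one, h2, hω.1] at h3
  exact zero_ne_one h3

theorem exists_stabilizes_of_mem_translateSpan {ω : Chain →ₗ[ℂ] ℂ} {θ : ℂ} {ξ : Phase}
    (hω : IsPureStabilizerState ω θ ξ) {g : Phase} (hg : g ∈ translateSpan ξ) :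
    ∃ μ : ℂ, ‖μ‖ = 1 ∧ Stabilizes (μ • weyl g) ω := by
  induction hg using Submodule.span_induction with
  | mem g hg =>
    obtain ⟨x, rfl⟩ := hg
    exact ⟨θ, hω.phase, hω.stabilized x⟩
  | zero => exact ⟨1, by simp, by simpa using stabilizes_one ω⟩
  | add g h _ _ hg hh =>
    obtain ⟨μ, hμ, hg⟩ := hg
    obtain ⟨ν, hν, hh⟩ := hh
    refine ⟨μ * ν * sgn (cocycle g h), by simp [hμ, hν], ?_⟩
    have := hg.mul hh
    rwa [smul_mul_smul_comm, weyl_mul, smul_smul] at this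
  | smul t g _ hg =>
    rcases zmod_two_cases t with rfl | rfl
    · exact ⟨1, by simp, by simpa using stabilizes_one ω⟩
    · simpa using hg

theorem symp_eq_zero_of_mem_translateSpan {ω : Chain →ₗ[ℂ] ℂ} {θ : ℂ} {ξ : Phase}
    (hω : IsPureStabilizerState ω θ ξ) {g h : Phase} (hg : g ∈ translateSpan ξ)
    (hh : h ∈ translateSpan ξ) : symp g h = 0 := by
  obtain ⟨μ, hμ, hg⟩ := exists_stabilizes_of_mem_translateSpan hω hg
  obtain ⟨ν, -, hh⟩ := exists_stabilizes_of_mem_translateSpan hω hh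
  exact symp_eq_zero_of_stabilizes hω.pure.1 hμ hg hh

/-- Finite truncations of a phase space vector of infinite support that represents the linear
functional `f` by means of the symplectic form. -/
def truncatedDual (f : Phase →ₗ[ZMod 2] ZMod 2) (F : Finset ℤ) : Phase :=
  ∑ x ∈ F, Finsupp.single x (f (Finsupp.single x (0, 1)), f (Finsupp.single x (1, 0)))

/-- The form pairs X with Z, hence the swapped coordinates in `truncatedDual`; sites outside the
support of ν play no role. -/
theorem symp_truncatedDual (f : Phase →ₗ[ZMod 2] ZMod 2) {F : Finset ℤ} {ν : Phase}
    (h : ν.support ⊆ F) : symp (truncatedDual f F) ν = f ν := by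
  have h1 : ν = ∑ x ∈ F, ((ν x).1 • Finsupp.single x ((1, 0) : ZMod 2 × ZMod 2) +
      (ν x).2 • Finsupp.single x ((0, 1) : ZMod 2 × ZMod 2)) := by
    conv_lhs => rw [← ν.sum_single, Finsupp.sum]
    rw [Finset.sum_subset h (fun x _ hx => by simp [Finsupp.notMem_support_iff.1 hx])]
    refine Finset.sum_congr rfl fun x _ => ?_
    rw [Finsupp.smul_single, Finsupp.smul_single, ← Finsupp.single_add]
    simp
  conv_rhs => rw [h1, map_sum]
  rw [truncatedDual, map_sum, LinearMap.sum_apply]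
  refine Finset.sum_congr rfl fun x _ => ?_
  rw [symp_single_left, map_add, map_smul, map_smul, smul_eq_mul, smul_eq_mul]
  ring

theorem star_weyl_mul_weyl_mul_weyl (ζ ν : Phase) :
    star (weyl ζ) * weyl ν * weyl ζ = sgn (symp ζ ν) • weyl ν := by
  rw [mul_assoc, weyl_mul_comm ν, symp_comm, mul_smul_comm, ← mul_assoc, star_mul_weyl_self,
    one_mul]

theorem exists_ultrafilter_limit {ι : Type*} (u : Ultrafilter ι) (g : ι → ℂ) {C : ℝ}
    (hg : ∀ i, ‖g i‖ ≤ C) : ∃ z, Tendsto g u (𝓝 z) := by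
  obtain ⟨z, -, hz⟩ := (isCompact_closedBall (0 : ℂ) C).ultrafilter_le_nhds (u.map g)
    (le_principal_iff.2 (mem_map.2 (univ_mem' fun i => by simpa using hg i)))
  exact ⟨z, hz⟩

/-- Limits of conjugates of a state by Pauli products that represent a functional `f`: there is a
state whose expectation of each Pauli product `w(ν)` is multiplied by `(-1) ^ f ν`, and that is
stabilized by the Pauli stabilizers in the kernel of `f`. -/
theorem exists_state_twist {ω : Chain →ₗ[ℂ] ℂ} (hω : ω ∈ states)
    (f : Phase →ₗ[ZMod 2] ZMod 2) :
    ∃ φ ∈ states, (∀ ν, φ (weyl ν) = sgn (f ν) * ω (weyl ν)) ∧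
      ∀ (μ : ℂ) (ν : Phase), f ν = 0 → Stabilizes (μ • weyl ν) ω →
        Stabilizes (μ • weyl ν) φ := by
  -- Along an ultrafilter all bounded expectations converge at once, which makes the limit linear;
  -- refining `atTop` makes each truncation eventually exact.
  let u : Ultrafilter (Finset ℤ) := Ultrafilter.of atTop
  have hu : (u : Filter (Finset ℤ)) ≤ atTop := Ultrafilter.of_le atTop
  let w : Finset ℤ → Chain := fun F => weyl (truncatedDual f F)
  let Ω : Chain →L[ℂ] ℂ := ⟨ω, continuous_of_mem_states hω⟩
  have hlim : ∀ a, ∃ z, Tendsto (fun F => ω (star (w F) * a * w F)) u (𝓝 z) := fun a =>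
    exists_ultrafilter_limit u _ (C := ‖Ω‖ * ‖a‖) fun F => by
      refine (Ω.le_opNorm _).trans (mul_le_mul_of_nonneg_left ?_ (norm_nonneg _))
      have hw : ‖w F‖ ≤ 1 := norm_weyl_le _
      calc ‖star (w F) * a * w F‖ ≤ ‖star (w F)‖ * ‖a‖ * ‖w F‖ :=
            (norm_mul_le _ _).trans (mul_le_mul_of_nonneg_right (norm_mul_le _ _) (norm_nonneg _))
        _ ≤ 1 * ‖a‖ * 1 := by
            have hw' : ‖star (w F)‖ ≤ 1 := (norm_star (w F)).trans_le hw
            gcongr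
        _ = ‖a‖ := by ring
  choose φ hφ using hlim
  have hcomm : ∀ ν, ∀ᶠ F in (u : Filter (Finset ℤ)), symp (truncatedDual f F) ν = f ν := fun ν =>
    hu ((eventually_ge_atTop ν.support).mono fun F hF => symp_truncatedDual f hF)
  let φ' : Chain →ₗ[ℂ] ℂ :=
    { toFun := φ
      map_add' := fun a b => tendsto_nhds_unique (hφ (a + b)) (by
        simpa only [mul_add, add_mul, map_add] using (hφ a).add (hφ b))
      map_smul' := fun t a => tendsto_nhds_unique (hφ (t • a)) (by
        simpa only [mul_smul_comm, smul_mul_assoc, map_smul, smul_eq_mul, RingHom.id_apply]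
          using (hφ a).const_mul t) }
  refine ⟨φ', ⟨?_, fun a => ?_⟩, fun ν => ?_, fun μ ν hν hs a => ?_⟩
  · refine tendsto_nhds_unique (hφ 1) ?_
    simp only [mul_one, w, star_mul_weyl_self, hω.1]
    exact tendsto_const_nhds
  · refine ge_of_tendsto' (hφ (star a * a)) fun F => ?_
    have := hω.2 (a * w F)
    rwa [star_mul, mul_assoc, ← mul_assoc (star a), ← mul_assoc] at this
  · refine tendsto_nhds_unique (hφ (weyl ν)) (tendsto_const_nhds.congr' ?_)
    filter_upwards [hcomm ν] with F hF
    rw [star_weyl_mul_weyl_mul_weyl, hF, map_smul, smul_eq_mul]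
  · refine tendsto_nhds_unique (hφ _) ((hφ a).congr' ?_)
    filter_upwards [hcomm ν] with F hF
    rw [hν] at hF
    have h1 : star (w F) * weyl ν = weyl ν * star (w F) := by
      simp only [w, star_weyl, smul_mul_assoc, mul_smul_comm]
      rw [weyl_mul_comm, hF, sgn_zero, one_smul]
    have h2 : star (w F) * (μ • weyl ν * a) * w F = μ • weyl ν * (star (w F) * a * w F) := by
      rw [← mul_assoc (star _), mul_smul_comm, h1, ← smul_mul_assoc]
      simp only [mul_assoc]
    rw [h2, hs]

/-- If a self-adjoint unitary `W` has expectation `0`, conditioning on its value `1` gives a state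
in which its expectation is `1`. -/
theorem exists_state_conditioned {ω : Chain →ₗ[ℂ] ℂ} (hω : ω ∈ states) {W : Chain}
    (hstar : star W = W) (hsq : W * W = 1) (h0 : ω W = 0) :
    ∃ φ ∈ states, φ W = 1 ∧ ∀ S, S * W = W * S → Stabilizes S ω → Stabilizes S φ := by
  let φ : Chain →ₗ[ℂ] ℂ :=
    { toFun := fun a => 2⁻¹ * ω ((1 + W) * a * (1 + W))
      map_add' := fun a b => by simp only [mul_add, add_mul, map_add]; ring
      map_smul' := fun t a => by
        simp only [mul_smul_comm, smul_mul_assoc, map_smul, smul_eq_mul, RingHom.id_apply]; ring }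
  have hφ : ∀ a, φ a = 2⁻¹ * ω ((1 + W) * a * (1 + W)) := fun _ => rfl
  refine ⟨φ, ⟨?_, fun a => ?_⟩, ?_, fun S hS hs a => ?_⟩
  · rw [hφ, mul_one, mul_add, mul_one, add_mul, one_mul, hsq]
    simp only [map_add, h0, hω.1]
    norm_num
  · rw [hφ]
    have := hω.2 (a * (1 + W))
    rw [star_mul, star_add, star_one, hstar, mul_assoc, ← mul_assoc (star a), ← mul_assoc] at this
    exact mul_nonneg (inv_nonneg.2 zero_le_two) this
  · rw [hφ, add_mul, one_mul, hsq, mul_add, mul_one, add_mul, one_mul, hsq]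
    simp only [map_add, h0, hω.1]
    norm_num
  · have : (1 + W) * (S * a) * (1 + W) = S * ((1 + W) * a * (1 + W)) := by
      rw [← mul_assoc, show (1 + W) * S = S * (1 + W) by rw [add_mul, mul_add, hS, one_mul, mul_one]]
      simp only [mul_assoc]
    rw [hφ, hφ, this, hs]

/-- Maximality: a Pauli product that commutes with all translates of the generator is, up to a phase,
a product of such translates. -/
theorem mem_translateSpan_of_symp_eq_zero {ω : Chain →ₗ[ℂ] ℂ} {θ : ℂ} {ξ : Phase}
    (hω : IsPureStabilizerState ω θ ξ) {η : Phase} (hη : ∀ x, symp (translate x ξ) η = 0) :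
    η ∈ translateSpan ξ := by
  by_contra hmem
  obtain ⟨f, hfη, hf⟩ := Submodule.exists_le_ker_of_notMem hmem
  obtain ⟨φ, hφ, hφw, hφs⟩ := exists_state_twist hω.pure.1 f
  -- The twist by f keeps all generators as stabilizers but reverses the sign of the expectation of
  -- w(η).
  have h1 : φ = ω := hω.determined φ hφ fun x =>
    hφs θ _ (hf (Submodule.subset_span ⟨x, rfl⟩)) (hω.stabilized x)
  have h2 : ω (weyl η) = 0 := by
    have := hφw η
    rw [h1, (zmod_two_cases _).resolve_left hfη, sgn_one, neg_one_mul] at this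
    exact self_eq_neg.1 this
  obtain ⟨c, -, hstar, hsq⟩ := exists_phase_isSelfAdjoint η
  have h3 : ω (c • weyl η) = 0 := by rw [map_smul, h2, smul_zero]
  -- Since w(η) commutes with the generators, conditioning on it preserves them too, yet changes its
  -- expectation from 0 to 1.
  obtain ⟨ψ, hψ, hψ1, hψs⟩ := exists_state_conditioned hω.pure.1 hstar hsq h3
  have h4 : ψ = ω := hω.determined ψ hψ fun x => hψs _ (by
    rw [smul_mul_smul_comm, smul_mul_smul_comm, weyl_mul_comm, hη, sgn_zero, one_smul, mul_comm])
    (hω.stabilized x)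
  rw [h4, h3] at hψ1
  exact zero_ne_one hψ1

theorem apply_weyl_eq_zero {ω : Chain →ₗ[ℂ] ℂ} {θ : ℂ} {ξ : Phase}
    (hω : IsPureStabilizerState ω θ ξ) {η : Phase} (hη : η ∉ translateSpan ξ) :
    ω (weyl η) = 0 := by
  have h1 : ∃ x, symp (translate x ξ) η ≠ 0 := by
    by_contra! h
    exact hη (mem_translateSpan_of_symp_eq_zero hω h)
  obtain ⟨x, hx⟩ := h1
  refine (hω.stabilized x).apply_eq_zero_of_anticommute hω.pure.1
    (smul_weyl_mul_star_self hω.phase _) ?_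
  rw [smul_mul_assoc, weyl_mul_comm, (zmod_two_cases _).resolve_left hx, sgn_one, neg_one_smul,
    smul_neg, mul_smul_comm]


/-! ### Symplectic bases -/

/-- Split off a hyperbolic plane spanned by e and f; its orthogonal complement is again
nondegenerate, of dimension smaller by 2. -/
theorem exists_symplectic_family {K : Type*} [Field K] (d : ℕ) :
    ∀ {V : Type*} [AddCommGroup V] [Module K V] [FiniteDimensional K V]
      (B : V →ₗ[K] V →ₗ[K] K), (∀ v, B v v = 0) → (∀ v, (∀ w, B v w = 0) → v = 0) →
      Module.finrank K V = d → ∃ n, d = 2 * n ∧ ∃ e f : Fin n → V,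
        (∀ i j, B (e i) (e j) = 0) ∧ (∀ i j, B (f i) (f j) = 0) ∧
          ∀ i j, B (e i) (f j) = if i = j then 1 else 0 := by
  induction d using Nat.strong_induction_on with
  | _ d ih =>
    intro V _ _ _ B halt hnd hd
    have hneg : ∀ v w, B v w = -B w v := fun v w => by
      have := halt (v + w)
      simp only [map_add, LinearMap.add_apply, halt, zero_add, add_zero] at this
      exact eq_neg_of_add_eq_zero_right this
    rcases Nat.eq_zero_or_pos d with rfl | hpos
    · exact ⟨0, rfl, Fin.elim0, Fin.elim0, fun i => i.elim0, fun i => i.elim0, fun i => i.elim0⟩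
    have : Nontrivial V := Module.finrank_pos_iff.1 (hd ▸ hpos)
    obtain ⟨e, he⟩ := exists_ne (0 : V)
    obtain ⟨f, hf⟩ : ∃ f, B e f = 1 := by
      obtain ⟨w, hw⟩ : ∃ w, B e w ≠ 0 := by
        by_contra! h
        exact he (hnd e h)
      exact ⟨(B e w)⁻¹ • w, by rw [map_smul, smul_eq_mul, inv_mul_cancel₀ hw]⟩
    have hfe : B f e = -1 := by rw [hneg, hf]
    let T : V →ₗ[K] K × K := (B e).prod (B f)
    have hT : ∀ v, T v = (B e v, B f v) := fun _ => rfl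
    have hsurj : LinearMap.range T = ⊤ := by
      rw [LinearMap.range_eq_top]
      rintro ⟨s, t⟩
      refine ⟨s • f - t • e, ?_⟩
      rw [hT]
      simp [hf, hfe, halt]
    have hrank := T.finrank_range_add_finrank_ker
    rw [hsurj, finrank_top, Module.finrank_prod, Module.finrank_self, hd] at hrank
    have hker : ∀ {w}, w ∈ LinearMap.ker T ↔ B e w = 0 ∧ B f w = 0 := fun {w} => by
      rw [LinearMap.mem_ker, hT, Prod.mk_eq_zero]
    obtain ⟨n, hn, e', f', hee, hff, hef⟩ := ih _ (by omega)
      (V := LinearMap.ker T) (B.compl₁₂ (LinearMap.ker T).subtype (LinearMap.ker T).subtype)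
      (fun v => halt _) (fun v hv => by
        refine Subtype.ext (hnd _ fun w => ?_)
        obtain ⟨hve, hvf⟩ := hker.1 v.2
        -- The test vector is the projection of w to the complement of the plane.
        have h1 := hv ⟨w - B e w • f + B f w • e, hker.2 (by simp [hf, hfe, halt])⟩
        simpa [hneg v e, hneg v f, hve, hvf] using h1) rfl
    have hL : ∀ w : LinearMap.ker T, B e w = 0 ∧ B f w = 0 ∧ B w e = 0 ∧ B w f = 0 := fun w => by
      obtain ⟨h1, h2⟩ := hker.1 w.2
      exact ⟨h1, h2, by rw [hneg, h1, neg_zero], by rw [hneg, h2, neg_zero]⟩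
    refine ⟨n + 1, by omega, Fin.cons e fun i => e' i, Fin.cons f fun i => f' i, ?_, ?_, ?_⟩
    · intro i j
      refine Fin.cases ?_ (fun i => ?_) i <;> refine Fin.cases ?_ (fun j => ?_) j
      · simpa using halt e
      · simpa using (hL (e' j)).1
      · simpa using (hL (e' i)).2.2.1
      · simpa using hee i j
    · intro i j
      refine Fin.cases ?_ (fun i => ?_) i <;> refine Fin.cases ?_ (fun j => ?_) j
      · simpa using halt f
      · simpa using (hL (f' j)).2.1
      · simpa using (hL (f' i)).2.2.2
      · simpa using hff i j
    · intro i j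
      refine Fin.cases ?_ (fun i => ?_) i <;> refine Fin.cases ?_ (fun j => ?_) j
      · simpa using hf
      · simpa [(Fin.succ_ne_zero j).symm] using (hL (f' j)).1
      · simpa using (hL (e' i)).2.2.2
      · simpa using hef i j

/-! ### Combinations of translates and their supports -/

theorem translate_apply (x : ℤ) (ξ : Phase) (y : ℤ) : translate x ξ y = ξ (y - x) := by
  simp [translate, sub_eq_add_neg]

/-- Linear combinations of translates of `ξ`. -/
def comb (ξ : Phase) : (ℤ →₀ ZMod 2) →ₗ[ZMod 2] Phase :=
  Finsupp.linearCombination (ZMod 2) fun x => translate x ξ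

theorem comb_apply (ξ : Phase) (c : ℤ →₀ ZMod 2) (y : ℤ) :
    comb ξ c y = ∑ x ∈ c.support, c x • ξ (y - x) := by
  simp [comb, Finsupp.linearCombination_apply, Finsupp.sum, translate_apply, Finsupp.finsetSum_apply]

theorem mem_translateSpan_iff_exists_comb {ξ g : Phase} :
    g ∈ translateSpan ξ ↔ ∃ c, comb ξ c = g := by
  rw [translateSpan, ← Finsupp.range_linearCombination]
  exact LinearMap.mem_range

theorem comb_mem (ξ : Phase) (c : ℤ →₀ ZMod 2) : comb ξ c ∈ translateSpan ξ :=
  mem_translateSpan_iff_exists_comb.2 ⟨c, rfl⟩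

theorem comb_single (ξ : Phase) (x : ℤ) : comb ξ (Finsupp.single x 1) = translate x ξ := by
  simp [comb]

/-- Nothing cancels at the right end: the rightmost translate with nonzero coefficient is alone at
its last site. -/
theorem lt_of_supportedIn_Iio_comb {ξ : Phase} {M : ℤ} (hM : ξ M ≠ 0) (hξ : ∀ y, M < y → ξ y = 0)
    {c : ℤ →₀ ZMod 2} {k : ℤ} (hc : SupportedIn (Set.Iio k) (comb ξ c)) {x : ℤ} (hx : c x ≠ 0) :
    x + M < k := by
  have hx' : x ∈ c.support := Finsupp.mem_support_iff.2 hx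
  have hne : c.support.Nonempty := ⟨x, hx'⟩
  have hle : ∀ z ∈ c.support, z ≤ c.support.max' hne := fun z hz => c.support.le_max' z hz
  have hmem := c.support.max'_mem hne
  generalize c.support.max' hne = z at hle hmem
  have h1 : comb ξ c (z + M) = c z • ξ M := by
    rw [comb_apply, Finset.sum_eq_single z _ fun h => absurd hmem h]
    · rw [add_sub_cancel_left]
    · intro y hy hne
      have := hle y hy
      rw [hξ _ (by omega), smul_zero]
  have h2 : z + M < k := hc _ (by
    rw [h1, (zmod_two_cases _).resolve_left (Finsupp.mem_support_iff.1 hmem), one_smul]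
    exact hM)
  have := hle x hx'
  omega

theorem le_of_supportedIn_Ici_comb {ξ : Phase} {M : ℤ} (hM : ξ M ≠ 0) (hξ : ∀ y, y < M → ξ y = 0)
    {c : ℤ →₀ ZMod 2} {k : ℤ} (hc : SupportedIn (Set.Ici k) (comb ξ c)) {x : ℤ} (hx : c x ≠ 0) :
    k ≤ x + M := by
  have hx' : x ∈ c.support := Finsupp.mem_support_iff.2 hx
  have hne : c.support.Nonempty := ⟨x, hx'⟩
  have hle : ∀ z ∈ c.support, c.support.min' hne ≤ z := fun z hz => c.support.min'_le z hz
  have hmem := c.support.min'_mem hne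
  generalize c.support.min' hne = z at hle hmem
  have h1 : comb ξ c (z + M) = c z • ξ M := by
    rw [comb_apply, Finset.sum_eq_single z _ fun h => absurd hmem h]
    · rw [add_sub_cancel_left]
    · intro y hy hne
      have := hle y hy
      rw [hξ _ (by omega), smul_zero]
  have h2 : k ≤ z + M := hc _ (by
    rw [h1, (zmod_two_cases _).resolve_left (Finsupp.mem_support_iff.1 hmem), one_smul]
    exact hM)
  have := hle x hx'
  omega

/-! ### Cutting labels at k -/

/-- The part of a label on the sites `x < k`. -/
def leftPart (k : ℤ) : Phase →ₗ[ZMod 2] Phase where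
  toFun ν := ν.filter (· < k)
  map_add' _ _ := Finsupp.filter_add
  map_smul' _ _ := Finsupp.filter_smul

/-- The part of a label on the sites `k ≤ x`. -/
def rightPart (k : ℤ) : Phase →ₗ[ZMod 2] Phase where
  toFun ν := ν.filter (k ≤ ·)
  map_add' _ _ := Finsupp.filter_add
  map_smul' _ _ := Finsupp.filter_smul

theorem leftPart_apply (k : ℤ) (ν : Phase) (x : ℤ) :
    leftPart k ν x = if x < k then ν x else 0 := Finsupp.filter_apply _ _ _

theorem rightPart_apply (k : ℤ) (ν : Phase) (x : ℤ) :
    rightPart k ν x = if k ≤ x then ν x else 0 := Finsupp.filter_apply _ _ _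

theorem leftPart_add_rightPart (k : ℤ) (ν : Phase) : leftPart k ν + rightPart k ν = ν := by
  refine Finsupp.ext fun x => ?_
  rw [Finsupp.add_apply, leftPart_apply, rightPart_apply]
  split_ifs <;> first | omega | simp

theorem supportedIn_leftPart (k : ℤ) (ν : Phase) : SupportedIn (Set.Iio k) (leftPart k ν) :=
  fun x hx => by
    by_contra h
    exact hx ((leftPart_apply k ν x).trans (if_neg h))

theorem supportedIn_rightPart (k : ℤ) (ν : Phase) : SupportedIn (Set.Ici k) (rightPart k ν) :=
  fun x hx => by
    by_contra h
    exact hx ((rightPart_apply k ν x).trans (if_neg h))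

theorem disjoint_Iio_Ici (k : ℤ) : Disjoint (Set.Iio k) (Set.Ici k) :=
  Set.disjoint_left.2 fun _ h h' => not_lt.2 (Set.mem_Ici.1 h') (Set.mem_Iio.1 h)

theorem symp_left_right {k : ℤ} {α β : Phase} (hα : SupportedIn (Set.Iio k) α)
    (hβ : SupportedIn (Set.Ici k) β) : symp α β = 0 :=
  symp_eq_zero_of_disjoint (hα.disjoint (disjoint_Iio_Ici k) hβ)

theorem leftPart_of_left {k : ℤ} {α : Phase} (hα : SupportedIn (Set.Iio k) α) :
    leftPart k α = α := by
  refine Finsupp.ext fun x => ?_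
  rw [leftPart_apply]
  split_ifs with h
  · rfl
  · exact (not_not.1 fun h' => h (hα x h')).symm

theorem leftPart_of_right {k : ℤ} {β : Phase} (hβ : SupportedIn (Set.Ici k) β) :
    leftPart k β = 0 := by
  refine Finsupp.ext fun x => ?_
  rw [leftPart_apply]
  split_ifs with h
  · exact not_not.1 fun h' => not_lt.2 (hβ x h') h
  · rfl

theorem symp_leftPart_of_left {k : ℤ} {α ν : Phase} (hα : SupportedIn (Set.Iio k) α) :
    symp α (leftPart k ν) = symp α ν := by
  conv_rhs => rw [← leftPart_add_rightPart k ν, map_add,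
    symp_left_right hα (supportedIn_rightPart k ν), add_zero]

theorem symp_eq_left_add_right (k : ℤ) (g h : Phase) :
    symp g h = symp (leftPart k g) (leftPart k h) + symp (rightPart k g) (rightPart k h) := by
  conv_lhs => rw [← leftPart_add_rightPart k g, ← leftPart_add_rightPart k h]
  rw [map_add, map_add, LinearMap.add_apply, LinearMap.add_apply,
    symp_left_right (supportedIn_leftPart k g) (supportedIn_rightPart k h),
    symp_comm (rightPart k g) (leftPart k h),
    symp_left_right (supportedIn_leftPart k h) (supportedIn_rightPart k g), add_zero, zero_add]


/-! ### Crossing translates and the construction of the pairs -/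

/-- The support of `ξ` spans exactly the interval from `a` to `b`. -/
structure HasEnds (ξ : Phase) (a b : ℤ) : Prop where
  le : a ≤ b
  left_ne : ξ a ≠ 0
  right_ne : ξ b ≠ 0
  eq_zero_of_lt : ∀ y, y < a → ξ y = 0
  eq_zero_of_gt : ∀ y, b < y → ξ y = 0

theorem exists_hasEnds {ξ : Phase} (hξ : ξ ≠ 0) :
    ∃ a b, HasEnds ξ a b ∧ length ξ = (b - a).toNat + 1 := by
  have h := Finsupp.support_nonempty_iff.2 hξ
  have hle : ξ.support.min' h ≤ ξ.support.max' h := ξ.support.min'_le _ (ξ.support.max'_mem h)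
  refine ⟨ξ.support.min' h, ξ.support.max' h, ⟨hle, ?_, ?_, fun y hy => ?_, fun y hy => ?_⟩, ?_⟩
  · exact Finsupp.mem_support_iff.1 (ξ.support.min'_mem h)
  · exact Finsupp.mem_support_iff.1 (ξ.support.max'_mem h)
  · by_contra hne
    exact not_lt.2 (ξ.support.min'_le y (Finsupp.mem_support_iff.2 hne)) hy
  · by_contra hne
    exact not_lt.2 (ξ.support.le_max' y (Finsupp.mem_support_iff.2 hne)) hy
  · rw [length, dif_pos h]
    omega

/-- For ξ = 0 every label commutes with the generators, so maximality would put a nonzero label into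
the zero span. -/
theorem IsPureStabilizerState.ne_zero {ω : Chain →ₗ[ℂ] ℂ} {θ : ℂ} {ξ : Phase}
    (hω : IsPureStabilizerState ω θ ξ) : ξ ≠ 0 := by
  rintro rfl
  have h0 : ∀ x, translate x (0 : Phase) = 0 := fun x => by
    ext y <;> simp [translate_apply]
  have h1 : (Finsupp.single 0 (1, 0) : Phase) ∈ translateSpan 0 :=
    mem_translateSpan_of_symp_eq_zero hω fun x => by rw [h0, map_zero, LinearMap.zero_apply]
  obtain ⟨c, hc⟩ := mem_translateSpan_iff_exists_comb.1 h1
  have h2 := DFunLike.congr_fun hc 0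
  rw [comb_apply] at h2
  simp only [Finsupp.coe_zero, Pi.zero_apply, smul_zero, Finset.sum_const_zero,
    Finsupp.single_eq_same] at h2
  exact zero_ne_one (congrArg Prod.fst h2)

/-- Coefficients of the translates of `ξ` that have support on both sides of the cut at `k`. -/
abbrev crossing (a b k : ℤ) : Submodule (ZMod 2) (ℤ →₀ ZMod 2) :=
  -- The translate by x has ends x + a and x + b, and it crosses when x + a < k ≤ x + b.
  Finsupp.supported (ZMod 2) (ZMod 2) (Set.Ico (k - b) (k - a))

instance finite_crossing (a b k : ℤ) : Module.Finite (ZMod 2) (crossing a b k) :=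
  Module.Finite.equiv (Finsupp.supportedEquivFinsupp (Set.Ico (k - b) (k - a))).symm

theorem finrank_crossing (a b k : ℤ) :
    Module.finrank (ZMod 2) (crossing a b k) = (b - a).toNat := by
  rw [(Finsupp.supportedEquivFinsupp (Set.Ico (k - b) (k - a))).finrank_eq,
    Module.finrank_finsupp_self]
  simp

theorem eq_zero_of_mem_crossing {a b k : ℤ} {c : ℤ →₀ ZMod 2} (hc : c ∈ crossing a b k) {x : ℤ}
    (hx : ¬ (k - b ≤ x ∧ x < k - a)) : c x = 0 := by
  by_contra h
  exact hx (((Finsupp.mem_supported _ _).1 hc) (Finsupp.mem_support_iff.2 h))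

section

variable {ω : Chain →ₗ[ℂ] ℂ} {θ : ℂ} {ξ : Phase} {a b : ℤ}

theorem supportedIn_Iio_translate (hξ : HasEnds ξ a b) {k x : ℤ} (hx : x + b < k) :
    SupportedIn (Set.Iio k) (translate x ξ) := fun y hy => by
  by_contra h
  rw [Set.mem_Iio] at h
  exact hy (by rw [translate_apply, hξ.eq_zero_of_gt _ (by omega)])

theorem supportedIn_Ici_translate (hξ : HasEnds ξ a b) {k x : ℤ} (hx : k ≤ x + a) :
    SupportedIn (Set.Ici k) (translate x ξ) := fun y hy => by
  by_contra h
  rw [Set.mem_Ici] at h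
  exact hy (by rw [translate_apply, hξ.eq_zero_of_lt _ (by omega)])

/-- A combination of translates that cross the cut is trivial if its left part belongs to the
stabilizer group. -/
theorem eq_zero_of_leftPart_comb_mem (hξ : HasEnds ξ a b)
    {k : ℤ} {c : ℤ →₀ ZMod 2} (hc : c ∈ crossing a b k)
    (h : leftPart k (comb ξ c) ∈ translateSpan ξ) : c = 0 := by
  obtain ⟨c₁, hc₁⟩ := mem_translateSpan_iff_exists_comb.1 h
  have hl : SupportedIn (Set.Iio k) (comb ξ c₁) := hc₁ ▸ supportedIn_leftPart k _
  have hr : SupportedIn (Set.Ici k) (comb ξ (c - c₁)) := by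
    rw [map_sub, hc₁]
    conv => arg 2; arg 1; rw [← leftPart_add_rightPart k (comb ξ c)]
    rw [add_sub_cancel_left]
    exact supportedIn_rightPart k _
  refine Finsupp.ext fun x => ?_
  by_contra hx
  -- At a crossing x, the left support of `comb ξ c₁` forces c₁ x = 0; the right support of the
  -- difference then forces k ≤ x + a.
  by_cases hJ : k - b ≤ x ∧ x < k - a
  · have h1 : c₁ x = 0 := by
      by_contra h
      have := lt_of_supportedIn_Iio_comb hξ.right_ne hξ.eq_zero_of_gt hl h
      omega
    have := le_of_supportedIn_Ici_comb hξ.left_ne hξ.eq_zero_of_lt hr (x := x)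
      (by rwa [Finsupp.sub_apply, h1, sub_zero])
    omega
  · exact hx (eq_zero_of_mem_crossing hc hJ)

/-- The commutation form of the left parts of the translates crossing the cut at `k`. -/
def crossingForm (ξ : Phase) (a b k : ℤ) :
    crossing a b k →ₗ[ZMod 2] crossing a b k →ₗ[ZMod 2] ZMod 2 :=
  symp.compl₁₂ (leftPart k ∘ₗ comb ξ ∘ₗ (crossing a b k).subtype)
    (leftPart k ∘ₗ comb ξ ∘ₗ (crossing a b k).subtype)

theorem crossingForm_apply (k : ℤ) (c d : crossing a b k) :
    crossingForm ξ a b k c d = symp (leftPart k (comb ξ c)) (leftPart k (comb ξ d)) := rfl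

/-- A radical vector has a left part commuting with the crossing translates by assumption, with
those on the left by isotropy, and with those on the right by disjointness. Maximality applies. -/
theorem crossingForm_nondegenerate (hω : IsPureStabilizerState ω θ ξ) (hξ : HasEnds ξ a b) (k : ℤ)
    (c : crossing a b k) (hc : ∀ d, crossingForm ξ a b k c d = 0) : c = 0 := by
  refine Subtype.ext (eq_zero_of_leftPart_comb_mem hξ c.2 ?_)
  refine mem_translateSpan_of_symp_eq_zero hω fun x => ?_
  rw [symp_comm]
  by_cases hJ : k - b ≤ x ∧ x < k - a
  · have h := hc ⟨Finsupp.single x 1, Finsupp.single_mem_supported _ _ hJ⟩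
    rw [crossingForm_apply, comb_single, symp_leftPart_of_left (supportedIn_leftPart k _)] at h
    exact h
  by_cases hx : x + b < k
  · have hl := supportedIn_Iio_translate hξ hx
    rw [symp_comm, symp_leftPart_of_left hl]
    exact symp_eq_zero_of_mem_translateSpan hω (Submodule.subset_span ⟨x, rfl⟩) (comb_mem _ _)
  · exact symp_left_right (supportedIn_leftPart k _) (supportedIn_Ici_translate hξ (by omega))

/-- The stabilizer group element with given left part and right part can be corrected by a
combination of crossing translates to one whose parts separately belong to the stabilizer group. -/
theorem exists_crossing_correction (hξ : HasEnds ξ a b) {k : ℤ} {α β : Phase}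
    (hα : SupportedIn (Set.Iio k) α) (hβ : SupportedIn (Set.Ici k) β)
    (h : α + β ∈ translateSpan ξ) :
    ∃ c ∈ crossing a b k, α + leftPart k (comb ξ c) ∈ translateSpan ξ ∧
      β + rightPart k (comb ξ c) ∈ translateSpan ξ := by
  obtain ⟨c, hc⟩ := mem_translateSpan_iff_exists_comb.1 h
  have hα' : leftPart k (comb ξ c) = α := by
    rw [hc, map_add, leftPart_of_left hα, leftPart_of_right hβ, add_zero]
  -- The discarded translates lie on one side of the cut, so their left parts are themselves or 0.
  let c₀ := c.filter (· ∈ Set.Ico (k - b) (k - a))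
  have h1 : α + leftPart k (comb ξ c₀) ∈ translateSpan ξ := by
    have h2 : c = c₀ + c.filter (fun x => ¬ x ∈ Set.Ico (k - b) (k - a)) :=
      (Finsupp.filter_add_filter_not _ _).symm
    rw [← hα']
    conv => arg 2; arg 1; rw [h2]
    rw [map_add, map_add, add_right_comm, add_self_phase, zero_add, comb,
      Finsupp.linearCombination_apply, Finsupp.sum, map_sum]
    refine Submodule.sum_mem _ fun x hx => ?_
    rw [map_smul]
    refine Submodule.smul_mem _ _ ?_
    have hx' : ¬ (k - b ≤ x ∧ x < k - a) := by
      rw [Finsupp.support_filter, Finset.mem_filter] at hx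
      exact hx.2
    by_cases hxb : x + b < k
    · rw [leftPart_of_left (supportedIn_Iio_translate hξ hxb)]
      exact Submodule.subset_span ⟨x, rfl⟩
    · rw [leftPart_of_right (supportedIn_Ici_translate hξ (by omega))]
      exact Submodule.zero_mem _
  refine ⟨c₀, ?_, h1, ?_⟩
  · refine (Finsupp.mem_supported _ _).2 fun x hx => ?_
    have hx := Finset.mem_coe.1 hx
    rw [Finsupp.support_filter, Finset.mem_filter] at hx
    exact hx.2
  · have h3 : β + rightPart k (comb ξ c₀) =
        (α + β + comb ξ c₀) - (α + leftPart k (comb ξ c₀)) := by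
      conv_rhs => arg 1; arg 2; rw [← leftPart_add_rightPart k (comb ξ c₀)]
      abel
    rw [h3]
    exact Submodule.sub_mem _ (Submodule.add_mem _ h (comb_mem _ _)) h1

/-- The two parts of a stabilizer, with phases for which they are self-adjoint unitaries. -/
theorem exists_phases_of_mem (hω : IsPureStabilizerState ω θ ξ) (k : ℤ) {g : Phase}
    (hg : g ∈ translateSpan ξ) :
    ∃ s t : ℂ, ‖s‖ = 1 ∧ ‖t‖ = 1 ∧
      (star (s • weyl (leftPart k g)) = s • weyl (leftPart k g) ∧
        (s • weyl (leftPart k g)) * (s • weyl (leftPart k g)) = 1) ∧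
      (star (t • weyl (rightPart k g)) = t • weyl (rightPart k g) ∧
        (t • weyl (rightPart k g)) * (t • weyl (rightPart k g)) = 1) ∧
      Stabilizes ((s • weyl (leftPart k g)) * (t • weyl (rightPart k g))) ω := by
  obtain ⟨s, hs, hs1, hs2⟩ := exists_phase_isSelfAdjoint (leftPart k g)
  obtain ⟨t, ht, ht1, ht2⟩ := exists_phase_isSelfAdjoint (rightPart k g)
  obtain ⟨μ, hμ, hstab⟩ := exists_stabilizes_of_mem_translateSpan hω hg
  have hs0 : s ≠ 0 := norm_ne_zero_iff.1 (by rw [hs]; exact one_ne_zero)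
  have ht0 : t ≠ 0 := norm_ne_zero_iff.1 (by rw [ht]; exact one_ne_zero)
  have hcomm : weyl (rightPart k g) * weyl (leftPart k g) =
      weyl (leftPart k g) * weyl (rightPart k g) :=
    (weyl_commute_of_disjoint ((supportedIn_leftPart k g).disjoint (disjoint_Iio_Ici k)
      (supportedIn_rightPart k g))).symm
  have hprod : weyl (leftPart k g) * weyl (rightPart k g) = weyl g := by
    rw [weyl_mul, leftPart_add_rightPart, cocycle_eq_zero_of_disjoint
      ((supportedIn_leftPart k g).disjoint (disjoint_Iio_Ici k) (supportedIn_rightPart k g)),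
      sgn_zero, one_smul]
  have hsq : (s • weyl (leftPart k g)) * (s • weyl (leftPart k g)) *
      ((t • weyl (rightPart k g)) * (t • weyl (rightPart k g))) = ((s * t) * (s * t)) •
        (weyl g * weyl g) := by
    simp only [smul_mul_smul_comm]
    rw [← hprod, mul_assoc (weyl (leftPart k g)) (weyl (rightPart k g)),
      ← mul_assoc (weyl (rightPart k g)), hcomm]
    simp only [mul_assoc]
    congr 1
    ring
  have hμ2 := hstab.mul hstab 1
  -- The ratio between the stabilizing phase and the self-adjoint phases is ±1, because the square
  -- of the stabilizer is r² and has expectation 1. This sign is absorbed into t.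
  obtain ⟨r, hr⟩ : ∃ r, r = μ / (s * t) := ⟨_, rfl⟩
  have hr' : μ = r * (s * t) := by rw [hr]; field_simp
  have hr2 : r * r = 1 := by
    have h1 : (μ • weyl g) * (μ • weyl g) = (r * r) • (1 : Chain) := by
      rw [smul_mul_smul_comm, hr',
        show r * (s * t) * (r * (s * t)) = r * r * ((s * t) * (s * t)) by ring, ← smul_smul, ← hsq, hs2, ht2, one_mul]
    rw [h1, mul_one, map_smul, hω.pure.1.1, smul_eq_mul, mul_one] at hμ2
    exact hμ2
  have hrr : star r = r := by
    rcases mul_self_eq_one_iff.1 hr2 with rfl | rfl <;> simp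
  have hr1 : ‖r‖ = 1 := by
    rcases mul_self_eq_one_iff.1 hr2 with rfl | rfl <;> simp
  refine ⟨s, r * t, hs, by rw [norm_mul, hr1, ht, one_mul], ⟨hs1, hs2⟩, ⟨?_, ?_⟩, ?_⟩
  · rw [← smul_smul, star_smul, ht1, hrr]
  · rw [← smul_smul, smul_mul_smul_comm, ht2, hr2, one_smul]
  · rw [smul_mul_smul_comm, hprod, show s * (r * t) = μ by rw [hr']; ring]
    exact hstab

theorem smul_weyl_comm (s t : ℂ) {ξ η : Phase} (h : symp ξ η = 0) :
    (s • weyl ξ) * (t • weyl η) = (t • weyl η) * (s • weyl ξ) := by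
  rw [smul_mul_smul_comm, smul_mul_smul_comm, weyl_mul_comm, h, sgn_zero, one_smul, mul_comm]

theorem smul_weyl_anticomm (s t : ℂ) {ξ η : Phase} (h : symp ξ η = 1) :
    (s • weyl ξ) * (t • weyl η) = -((t • weyl η) * (s • weyl ξ)) := by
  rw [smul_mul_smul_comm, smul_mul_smul_comm, weyl_mul_comm, h, sgn_one, neg_one_smul, smul_neg,
    mul_comm]

/-- A symplectic basis of the crossing translates provides maximally entangled pairs. -/
theorem exists_pauli_pairs (hω : IsPureStabilizerState ω θ ξ) {n : ℕ} (k : ℤ)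
    (e f : Fin n → crossing a b k)
    (hee : ∀ i j, crossingForm ξ a b k (e i) (e j) = 0)
    (hff : ∀ i j, crossingForm ξ a b k (f i) (f j) = 0)
    (hef : ∀ i j, crossingForm ξ a b k (e i) (f j) = if i = j then 1 else 0) :
    ∃ XA ZA XB ZB : Fin n → Chain, MaximallyEntangledPairs ω k XA ZA XB ZB ∧
      ∀ i, IsPauliProduct (XA i) ∧ IsPauliProduct (ZA i) ∧
        IsPauliProduct (XB i) ∧ IsPauliProduct (ZB i) := by
  choose s t hs ht hsl htl hst using fun i => exists_phases_of_mem hω k (comb_mem ξ (e i))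
  choose s' t' hs' ht' hsl' htl' hst' using fun i => exists_phases_of_mem hω k (comb_mem ξ (f i))
  have hright : ∀ c d : crossing a b k, symp (rightPart k (comb ξ c)) (rightPart k (comb ξ d)) =
      crossingForm ξ a b k c d := fun c d => by
    have h := symp_eq_left_add_right k (comb ξ c) (comb ξ d)
    rw [symp_eq_zero_of_mem_translateSpan hω (comb_mem _ _) (comb_mem _ _)] at h
    rw [crossingForm_apply]
    exact (CharTwo.add_eq_zero.1 h.symm).symm
  have hmemL : ∀ (r : ℂ) (g : Phase), ((r • weyl (leftPart k g) : Chain) :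
      ChainSpace →L[ℂ] ChainSpace) ∈ observables (Set.Iio k) := fun r g =>
    (observables (Set.Iio k)).smul_mem (weylOp_mem_observables (supportedIn_leftPart k g)) r
  have hmemR : ∀ (r : ℂ) (g : Phase), ((r • weyl (rightPart k g) : Chain) :
      ChainSpace →L[ℂ] ChainSpace) ∈ observables (Set.Ici k) := fun r g =>
    (observables (Set.Ici k)).smul_mem (weylOp_mem_observables (supportedIn_rightPart k g)) r
  refine ⟨fun i => s i • weyl (leftPart k (comb ξ (e i))),
    fun i => s' i • weyl (leftPart k (comb ξ (f i))),
    fun i => t i • weyl (rightPart k (comb ξ (e i))),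
    fun i => t' i • weyl (rightPart k (comb ξ (f i))),
    ⟨fun _ => hmemL _ _, fun _ => hmemL _ _, fun _ => hmemR _ _, fun _ => hmemR _ _,
      ⟨fun i => (hsl i).1, fun i => (hsl' i).1, fun i => (hsl i).2, fun i => (hsl' i).2,
        fun i => smul_weyl_anticomm _ _ ?_, fun i j => smul_weyl_comm _ _ (hee i j),
        fun i j => smul_weyl_comm _ _ (hff i j), fun i j hij => smul_weyl_comm _ _ ?_⟩,
      ⟨fun i => (htl i).1, fun i => (htl' i).1, fun i => (htl i).2, fun i => (htl' i).2,
        fun i => smul_weyl_anticomm _ _ ?_, fun i j => smul_weyl_comm _ _ ?_,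
        fun i j => smul_weyl_comm _ _ ?_, fun i j hij => smul_weyl_comm _ _ ?_⟩,
      hst, hst'⟩,
    fun i => ⟨⟨_, _, hs i, rfl⟩, ⟨_, _, hs' i, rfl⟩, ⟨_, _, ht i, rfl⟩, ⟨_, _, ht' i, rfl⟩⟩⟩
  · exact (hef i i).trans (if_pos rfl)
  · exact (hef i j).trans (if_neg hij)
  · exact (hright _ _).trans ((hef i i).trans (if_pos rfl))
  · exact (hright _ _).trans (hee i j)
  · exact (hright _ _).trans (hff i j)
  · exact (hright _ _).trans ((hef i j).trans (if_neg hij))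

end


/-! ### Correlations across the cut -/

section

variable {ω : Chain →ₗ[ℂ] ℂ} {θ : ℂ} {ξ : Phase} {a b : ℤ}

theorem exists_smul_stabilizer_of_add_mem (hω : IsPureStabilizerState ω θ ξ) {α β : Phase}
    (h : α + β ∈ translateSpan ξ) :
    ∃ (r : ℂ) (S : Chain), Stabilizes S ω ∧ weyl α * weyl β = r • S := by
  obtain ⟨μ, hμ, hs⟩ := exists_stabilizes_of_mem_translateSpan hω h
  have hμ0 : μ ≠ 0 := norm_ne_zero_iff.1 (by rw [hμ]; exact one_ne_zero)
  exact ⟨sgn (cocycle α β) * μ⁻¹, _, hs, by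
    rw [weyl_mul, smul_smul, mul_assoc, inv_mul_cancel₀ hμ0, mul_one]⟩

theorem apply_weyl_mul_weyl_eq_zero (hω : IsPureStabilizerState ω θ ξ) {α β : Phase}
    (h : α + β ∉ translateSpan ξ) : ω (weyl α * weyl β) = 0 := by
  rw [weyl_mul, map_smul, apply_weyl_eq_zero hω h, smul_zero]

/-- The correlations between the half-chains of two Pauli products. -/
theorem apply_weyl_mul_weyl (hω : IsPureStabilizerState ω θ ξ) (hξ : HasEnds ξ a b) {k : ℤ}
    [Fintype (crossing a b k)] {μ : crossing a b k → ℂ}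
    (hμ : ∀ c : crossing a b k, Stabilizes (μ c • weyl (comb ξ c)) ω) {α β : Phase}
    (hα : SupportedIn (Set.Iio k) α) (hβ : SupportedIn (Set.Ici k) β) :
    ω (weyl α * weyl β) = ∑ c : crossing a b k, ω (weyl α * weyl (leftPart k (comb ξ c))) *
      (μ c * ω (weyl (rightPart k (comb ξ c)) * weyl β)) := by
  -- A term is nonzero only if both corrected halves are stabilizers up to phase: this happens for
  -- exactly one c if α + β is in the span, and for none otherwise.
  by_cases h : α + β ∈ translateSpan ξ
  · obtain ⟨c₀, hc₀, hl, hr⟩ := exists_crossing_correction hξ hα hβ h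
    rw [Finset.sum_eq_single ⟨c₀, hc₀⟩ _ fun h => absurd (Finset.mem_univ _) h]
    · obtain ⟨r, S, hS, hr1⟩ := exists_smul_stabilizer_of_add_mem hω hl
      obtain ⟨r', S', hS', hr2⟩ := exists_smul_stabilizer_of_add_mem hω (add_comm β _ ▸ hr)
      have hsymp : symp α (comb ξ c₀) = 0 := by
        rw [← symp_leftPart_of_left hα]
        have h1 : symp (α + leftPart k (comb ξ c₀)) (comb ξ c₀) = 0 :=
          symp_eq_zero_of_mem_translateSpan hω hl (comb_mem _ _)
        rwa [← symp_leftPart_of_left (hα.add (supportedIn_leftPart k _)), map_add,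
          LinearMap.add_apply, symp_self, add_zero] at h1
      have hprod : weyl (leftPart k (comb ξ c₀)) * weyl (rightPart k (comb ξ c₀)) =
          weyl (comb ξ c₀) := by
        rw [weyl_mul, leftPart_add_rightPart, cocycle_eq_zero_of_disjoint
          ((supportedIn_leftPart k _).disjoint (disjoint_Iio_Ici k) (supportedIn_rightPart k _)),
          sgn_zero, one_smul]
      have h1 := hμ ⟨c₀, hc₀⟩ (weyl α * weyl β)
      -- The inserted stabilizer commutes with w(α); moved between w(α) and w(β), it splits into the
      -- two corrections.
      have h2 : μ ⟨c₀, hc₀⟩ • weyl (comb ξ c₀) * (weyl α * weyl β) =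
          μ ⟨c₀, hc₀⟩ • ((r • S) * (r' • S')) := by
        rw [← hr1, ← hr2, mul_assoc (weyl α), ← mul_assoc (weyl (leftPart _ _)), hprod,
          ← mul_assoc (weyl α), weyl_mul_comm α (comb ξ c₀), hsymp, sgn_zero, one_smul, smul_mul_assoc,
          mul_assoc]
      have e1 : ω S = 1 := by rw [← mul_one S, hS, hω.pure.1.1]
      have e2 : ω S' = 1 := by rw [← mul_one S', hS', hω.pure.1.1]
      rw [← h1, h2, hr1, hr2, smul_mul_smul_comm]
      simp only [map_smul, smul_eq_mul]
      rw [hS, e1, e2]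
      ring
    · intro c _ hne
      rw [apply_weyl_mul_weyl_eq_zero hω, zero_mul]
      intro hmem
      refine hne (Subtype.ext ?_)
      have h1 : leftPart k (comb ξ (c - c₀)) ∈ translateSpan ξ := by
        have := Submodule.sub_mem _ hmem hl
        rwa [add_sub_add_left_eq_sub, ← map_sub, ← map_sub] at this
      exact sub_eq_zero.1 (eq_zero_of_leftPart_comb_mem hξ (Submodule.sub_mem _ c.2 hc₀) h1)
  · rw [apply_weyl_mul_weyl_eq_zero hω h]
    refine (Finset.sum_eq_zero fun c _ => ?_).symm
    by_cases h1 : α + leftPart k (comb ξ c) ∈ translateSpan ξ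
    · rw [apply_weyl_mul_weyl_eq_zero hω (α := rightPart k (comb ξ c)), mul_zero, mul_zero]
      intro h2
      refine h ?_
      have h3 : α + β = (α + leftPart k (comb ξ c)) + (rightPart k (comb ξ c) + β) - comb ξ c := by
        conv_rhs => arg 2; rw [← leftPart_add_rightPart k (comb ξ c)]
        abel
      rw [h3]
      exact Submodule.sub_mem _ (Submodule.add_mem _ h1 h2) (comb_mem _ _)
    · rw [apply_weyl_mul_weyl_eq_zero hω h1, zero_mul]

/-- The correlations between the half-chains factor through the crossing translates. -/
theorem apply_mul_eq_sum (hω : IsPureStabilizerState ω θ ξ) (hξ : HasEnds ξ a b) {k : ℤ}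
    [Fintype (crossing a b k)] {μ : crossing a b k → ℂ}
    (hμ : ∀ c : crossing a b k, Stabilizes (μ c • weyl (comb ξ c)) ω) (x y : Chain)
    (hx : (x : ChainSpace →L[ℂ] ChainSpace) ∈ observables (Set.Iio k))
    (hy : (y : ChainSpace →L[ℂ] ChainSpace) ∈ observables (Set.Ici k)) :
    ω (x * y) = ∑ c : crossing a b k, ω (x * weyl (leftPart k (comb ξ c))) *
      (μ c * ω (weyl (rightPart k (comb ξ c)) * y)) := by
  have hcont := continuous_of_mem_states hω.pure.1
  refine observables_induction (p := fun x => ω (x * y) = ∑ c : crossing a b k,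
    ω (x * weyl (leftPart k (comb ξ c))) * (μ c * ω (weyl (rightPart k (comb ξ c)) * y)))
    ?_ (by simp) (fun x x' h h' => ?_) (fun t x h => ?_) (fun α hα => ?_) x hx
  · refine isClosed_eq (hcont.comp (by fun_prop)) (continuous_finsetSum _ fun c _ => ?_)
    exact (hcont.comp (by fun_prop)).mul continuous_const
  · simp only [add_mul, map_add, h, h', Finset.sum_add_distrib]
  · simp only [smul_mul_assoc, map_smul, h, smul_eq_mul, Finset.mul_sum, mul_assoc]
  refine observables_induction (p := fun y => ω (weyl α * y) = ∑ c : crossing a b k,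
    ω (weyl α * weyl (leftPart k (comb ξ c))) * (μ c * ω (weyl (rightPart k (comb ξ c)) * y)))
    ?_ (by simp) (fun y y' h h' => ?_) (fun t y h => ?_) (fun β hβ => ?_) y hy
  · refine isClosed_eq (hcont.comp (by fun_prop)) (continuous_finsetSum _ fun c _ => ?_)
    exact continuous_const.mul (continuous_const.mul (hcont.comp (by fun_prop)))
  · simp only [mul_add, map_add, h, h', Finset.sum_add_distrib]
  · simp only [mul_smul_comm, map_smul, h, smul_eq_mul, Finset.mul_sum]
    exact Finset.sum_congr rfl fun c _ => by ring
  exact apply_weyl_mul_weyl hω hξ hμ hα hβ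

end

/-! ### Logical words and the upper bound -/

/-- The logical Pauli product `X ^ s Z ^ t` of one logical qubit. -/
def logicalPauli {m : ℕ} (X Z : Fin m → Chain) (v : Fin m → ZMod 2 × ZMod 2) (i : Fin m) : Chain :=
  X i ^ (v i).1.val * Z i ^ (v i).2.val

/-- The logical Pauli product with label `v`. -/
def logicalWord {m : ℕ} (X Z : Fin m → Chain) (v : Fin m → ZMod 2 × ZMod 2) : Chain :=
  ((List.finRange m).map (logicalPauli X Z v)).prod

theorem mul_list_prod_eq_smul {ι : Type*} (T : Chain) (P : ι → Chain) (s : ι → ℂ)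
    (h : ∀ i, T * P i = s i • (P i * T)) (l : List ι) :
    T * (l.map P).prod = (l.map s).prod • ((l.map P).prod * T) := by
  induction l with
  | nil => simp
  | cons i l ih =>
    rw [List.map_cons, List.prod_cons, List.map_cons, List.prod_cons, ← mul_assoc, h,
      smul_mul_assoc, mul_assoc, ih, mul_smul_comm, smul_smul, mul_assoc]

theorem mul_pow_val_eq_smul {T Y : Chain} {r : ZMod 2} (h : T * Y = sgn r • (Y * T)) (t : ZMod 2) :
    T * Y ^ t.val = sgn (r * t) • (Y ^ t.val * T) := by
  rcases zmod_two_cases t with rfl | rfl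
  · simp
  · simpa [ZMod.val_one] using h

/-- The exponents p and q record whether T anticommutes with the i-th X and Z; the other factors
contribute no sign. -/
theorem mul_logicalWord_eq_smul {m : ℕ} {X Z : Fin m → Chain} (i : Fin m) {T : Chain}
    {p q : ZMod 2}
    (hX : ∀ j, T * X j = sgn (if j = i then p else 0) • (X j * T))
    (hZ : ∀ j, T * Z j = sgn (if j = i then q else 0) • (Z j * T)) (v : Fin m → ZMod 2 × ZMod 2) :
    T * logicalWord X Z v = sgn (p * (v i).1 + q * (v i).2) • (logicalWord X Z v * T) := by
  have h := mul_list_prod_eq_smul T (logicalPauli X Z v)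
    (fun j => if j = i then sgn (p * (v i).1 + q * (v i).2) else 1) (fun j => by
      rw [logicalPauli, ← mul_assoc, mul_pow_val_eq_smul (hX j), smul_mul_assoc, mul_assoc,
        mul_pow_val_eq_smul (hZ j), mul_smul_comm, smul_smul, ← sgn_add, mul_assoc]
      split_ifs with hj
      · rw [hj]
      · simp) (List.finRange m)
  rwa [← Fin.prod_univ_def, Finset.prod_ite_eq' Finset.univ i, if_pos (Finset.mem_univ i)] at h

theorem LogicalPaulis.X_mul_word {m : ℕ} {X Z : Fin m → Chain} (h : LogicalPaulis X Z) (i : Fin m)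
    (v : Fin m → ZMod 2 × ZMod 2) :
    X i * logicalWord X Z v = sgn (v i).2 • (logicalWord X Z v * X i) := by
  have := mul_logicalWord_eq_smul (T := X i) (p := 0) (q := 1) i
    (fun j => by simpa using h.comm_XX i j) (fun j => by
      split_ifs with hj
      · simpa [hj] using h.anticomm i
      · simpa using h.comm_XZ i j (Ne.symm hj)) v
  simpa using this

theorem LogicalPaulis.Z_mul_word {m : ℕ} {X Z : Fin m → Chain} (h : LogicalPaulis X Z) (i : Fin m)
    (v : Fin m → ZMod 2 × ZMod 2) :
    Z i * logicalWord X Z v = sgn (v i).1 • (logicalWord X Z v * Z i) := by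
  have := mul_logicalWord_eq_smul (X := X) (T := Z i) (p := 1) (q := 0) i
    (fun j => by
      split_ifs with hj
      · subst hj
        simp [h.anticomm j]
      · simpa using (h.comm_XZ j i hj).symm) (fun j => by simpa using h.comm_ZZ i j) v
  simpa using this

theorem logicalPauli_mem {m : ℕ} {X Z : Fin m → Chain} {R : Set ℤ}
    (hX : ∀ i, (X i : ChainSpace →L[ℂ] ChainSpace) ∈ observables R)
    (hZ : ∀ i, (Z i : ChainSpace →L[ℂ] ChainSpace) ∈ observables R)
    (v : Fin m → ZMod 2 × ZMod 2) (i : Fin m) :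
    (logicalPauli X Z v i : ChainSpace →L[ℂ] ChainSpace) ∈ observables R :=
  mul_mem (pow_mem (hX i) _) (pow_mem (hZ i) _)

theorem list_prod_mem_observables {ι : Type*} {P : ι → Chain} {R : Set ℤ}
    (hP : ∀ i, (P i : ChainSpace →L[ℂ] ChainSpace) ∈ observables R) (l : List ι) :
    ((l.map P).prod : ChainSpace →L[ℂ] ChainSpace) ∈ observables R := by
  induction l with
  | nil => exact one_mem (observables R)
  | cons i l ih =>
    rw [List.map_cons, List.prod_cons]
    exact mul_mem (hP i) ih

section

variable {ω : Chain →ₗ[ℂ] ℂ} {k : ℤ} {m : ℕ} {XA ZA XB ZB : Fin m → Chain}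

theorem MaximallyEntangledPairs.word_mem_left (h : MaximallyEntangledPairs ω k XA ZA XB ZB)
    (v : Fin m → ZMod 2 × ZMod 2) :
    (logicalWord XA ZA v : ChainSpace →L[ℂ] ChainSpace) ∈ observables (Set.Iio k) :=
  list_prod_mem_observables (logicalPauli_mem h.XA_mem h.ZA_mem v) _

theorem MaximallyEntangledPairs.word_mem_right (h : MaximallyEntangledPairs ω k XA ZA XB ZB)
    (v : Fin m → ZMod 2 × ZMod 2) :
    (logicalWord XB ZB v : ChainSpace →L[ℂ] ChainSpace) ∈ observables (Set.Ici k) :=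
  list_prod_mem_observables (logicalPauli_mem h.XB_mem h.ZB_mem v) _

theorem MaximallyEntangledPairs.stabilizes_pauli (h : MaximallyEntangledPairs ω k XA ZA XB ZB)
    (v : Fin m → ZMod 2 × ZMod 2) (i : Fin m) :
    Stabilizes (logicalPauli XA ZA v i * logicalPauli XB ZB v i) ω := by
  have hc : ZA i * XB i = XB i * ZA i :=
    observables_commute (disjoint_Iio_Ici k) _ _ (h.ZA_mem i) (h.XB_mem i)
  unfold logicalPauli
  rcases zmod_two_cases (v i).1 with h1 | h1 <;> rcases zmod_two_cases (v i).2 with h2 | h2 <;>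
    rw [h1, h2] <;> simp only [ZMod.val_zero, ZMod.val_one, pow_zero, pow_one, one_mul, mul_one]
  · exact stabilizes_one ω
  · exact h.bell_Z i
  · exact h.bell_X i
  · rw [mul_assoc, ← mul_assoc (ZA i), hc, mul_assoc (XB i), ← mul_assoc]
    exact (h.bell_X i).mul (h.bell_Z i)

theorem MaximallyEntangledPairs.stabilizes_word (h : MaximallyEntangledPairs ω k XA ZA XB ZB)
    (v : Fin m → ZMod 2 × ZMod 2) :
    Stabilizes (logicalWord XA ZA v * logicalWord XB ZB v) ω := by
  unfold logicalWord
  induction List.finRange m with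
  | nil => simpa using stabilizes_one ω
  | cons i l ih =>
    have hc := observables_commute (disjoint_Iio_Ici k) _ _
      (list_prod_mem_observables (logicalPauli_mem h.XA_mem h.ZA_mem v) l)
      (logicalPauli_mem h.XB_mem h.ZB_mem v i)
    simp only [List.map_cons, List.prod_cons]
    rw [mul_assoc, ← mul_assoc (List.prod _), hc, mul_assoc (logicalPauli XB ZB v i), ← mul_assoc]
    exact (h.stabilizes_pauli v i).mul ih

/-- Different signs on the two sides make the stabilizer ST anticommute with xy. -/
theorem apply_mul_eq_zero_of_sgn (hω : ω ∈ states) {S T x y : Chain} {p q : ZMod 2}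
    (hST : Stabilizes (S * T) ω) (hS : star S = S) (hT : star T = T) (hS2 : S * S = 1)
    (hT2 : T * T = 1) (hSx : S * x = sgn p • (x * S)) (hTy : T * y = sgn q • (y * T))
    (hTx : T * x = x * T) (hSy : S * y = y * S) (hpq : p ≠ q) : ω (x * y) = 0 := by
  refine hST.apply_eq_zero_of_anticommute hω ?_ ?_
  · rw [star_mul, hS, hT, mul_assoc, ← mul_assoc T, hT2, one_mul, hS2]
  · have hsgn : sgn q * sgn p = -1 := by
      rw [← sgn_add]
      rcases zmod_two_cases p with rfl | rfl <;> rcases zmod_two_cases q with rfl | rfl <;>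
        simp_all
    calc S * T * (x * y) = S * (T * x) * y := by simp only [mul_assoc]
      _ = (S * x) * (T * y) := by rw [hTx]; simp only [mul_assoc]
      _ = (sgn q * sgn p) • (x * (S * y) * T) := by
        rw [hSx, hTy, smul_mul_smul_comm, mul_comm (sgn p)]; simp only [mul_assoc]
      _ = -(x * y * (S * T)) := by rw [hsgn, neg_one_smul, hSy]; simp only [mul_assoc]

theorem MaximallyEntangledPairs.apply_word_mul_word (hω : ω ∈ states)
    (h : MaximallyEntangledPairs ω k XA ZA XB ZB) (v w : Fin m → ZMod 2 × ZMod 2) :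
    ω (logicalWord XA ZA v * logicalWord XB ZB w) = if v = w then 1 else 0 := by
  split_ifs with hvw
  · rw [← hvw, ← mul_one (_ * _), h.stabilizes_word v, hω.1]
  obtain ⟨i, hi⟩ := Function.ne_iff.1 hvw
  have hcL : ∀ x : Chain, (x : ChainSpace →L[ℂ] ChainSpace) ∈ observables (Set.Iio k) →
      x * logicalWord XB ZB w = logicalWord XB ZB w * x := fun x hx =>
    observables_commute (disjoint_Iio_Ici k) _ _ hx (h.word_mem_right w)
  have hcR : ∀ y : Chain, (y : ChainSpace →L[ℂ] ChainSpace) ∈ observables (Set.Ici k) →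
      y * logicalWord XA ZA v = logicalWord XA ZA v * y := fun y hy =>
    (observables_commute (disjoint_Iio_Ici k) _ _ (h.word_mem_left v) hy).symm
  -- The Z pair detects a difference in the X exponents, the X pair one in the Z exponents.
  by_cases h2 : (v i).2 = (w i).2
  · exact apply_mul_eq_zero_of_sgn hω (h.bell_Z i) (h.logicalA.star_Z i) (h.logicalB.star_Z i)
      (h.logicalA.Z_sq i) (h.logicalB.Z_sq i) (h.logicalA.Z_mul_word i v)
      (h.logicalB.Z_mul_word i w) (hcR _ (h.ZB_mem i)) (hcL _ (h.ZA_mem i))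
      fun h1 => hi (Prod.ext h1 h2)
  · exact apply_mul_eq_zero_of_sgn hω (h.bell_X i) (h.logicalA.star_X i) (h.logicalB.star_X i)
      (h.logicalA.X_sq i) (h.logicalB.X_sq i) (h.logicalA.X_mul_word i v)
      (h.logicalB.X_mul_word i w) (hcR _ (h.XB_mem i)) (hcL _ (h.XA_mem i)) h2

/-- The number of maximally entangled pairs is at most half the number of crossing translates. -/
theorem MaximallyEntangledPairs.two_mul_le {θ : ℂ} {ξ : Phase} {a b : ℤ}
    (h : MaximallyEntangledPairs ω k XA ZA XB ZB) (hω : IsPureStabilizerState ω θ ξ)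
    (hξ : HasEnds ξ a b) : 2 * m ≤ (b - a).toNat := by
  have : Finite (crossing a b k) := Module.finite_of_finite (ZMod 2)
  have : Fintype (crossing a b k) := Fintype.ofFinite _
  choose μ _ hμ using fun c : crossing a b k =>
    exists_stabilizes_of_mem_translateSpan hω (comb_mem ξ c)
  let U : Matrix (Fin m → ZMod 2 × ZMod 2) (crossing a b k) ℂ := fun v c =>
    ω (logicalWord XA ZA v * weyl (leftPart k (comb ξ c)))
  let V : Matrix (crossing a b k) (Fin m → ZMod 2 × ZMod 2) ℂ := fun c w =>
    μ c * ω (weyl (rightPart k (comb ξ c)) * logicalWord XB ZB w)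
  -- The identity matrix of size 4^m factors through an index set of 2^(b - a) elements.
  have hUV : U * V = 1 := by
    ext v w
    rw [Matrix.mul_apply, Matrix.one_apply, ← h.apply_word_mul_word hω.pure.1 v w,
      apply_mul_eq_sum hω hξ hμ _ _ (h.word_mem_left v) (h.word_mem_right w)]
  have hrank := (Matrix.rank_mul_le_left U V).trans U.rank_le_card_width
  rw [hUV, Matrix.rank_one, Module.card_eq_pow_finrank (K := ZMod 2) (V := crossing a b k),
    finrank_crossing,
    Fintype.card_fun, Fintype.card_prod, ZMod.card, Fintype.card_fin,
    show 2 * 2 = 2 ^ 2 from rfl, ← pow_mul] at hrank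
  exact (Nat.pow_le_pow_iff_right one_lt_two).1 hrank

end

end QubitChain

end

theorem mainTheorem2 (ω : QubitChain.Chain →ₗ[ℂ] ℂ) (θ : ℂ) (ξ : QubitChain.Phase)
    (hω : QubitChain.IsPureStabilizerState ω θ ξ) :
    ∃ n : ℕ, QubitChain.length ξ = 2 * n + 1 ∧
      ∀ k : ℤ,
        QubitChain.entanglement ω k = n ∧
        ∃ XA ZA XB ZB : Fin n → QubitChain.Chain,
          QubitChain.MaximallyEntangledPairs ω k XA ZA XB ZB ∧
          ∀ i, QubitChain.IsPauliProduct (XA i) ∧ QubitChain.IsPauliProduct (ZA i) ∧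
            QubitChain.IsPauliProduct (XB i) ∧ QubitChain.IsPauliProduct (ZB i) := by
  obtain ⟨a, b, hξ, hlen⟩ := QubitChain.exists_hasEnds hω.ne_zero
  have hpairs := fun k => QubitChain.exists_symplectic_family _ (QubitChain.crossingForm ξ a b k)
    (fun c => QubitChain.symp_self _) (QubitChain.crossingForm_nondegenerate hω hξ k)
    (QubitChain.finrank_crossing a b k)
  -- The equation b - a = 2n determines n independently of the cut, so any cut can serve to define
  -- it.
  obtain ⟨n, hn, -⟩ := hpairs 0
  refine ⟨n, by rw [hlen, hn], fun k => ?_⟩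
  obtain ⟨n', hn', e, f, hee, hff, hef⟩ := hpairs k
  obtain rfl : n' = n := by omega
  have hex := QubitChain.exists_pauli_pairs hω k e f hee hff hef
  refine ⟨le_antisymm (iSup₂_le ?_) ?_, hex⟩
  · rintro m ⟨XA, ZA, XB, ZB, h⟩
    have := h.two_mul_le hω hξ
    exact_mod_cast (by omega : m ≤ n')
  · obtain ⟨XA, ZA, XB, ZB, h, -⟩ := hex
    exact le_iSup₂_of_le n' ⟨XA, ZA, XB, ZB, h⟩ le_rfl
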